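/- Let $d\ge 2$, $\omega=e^{2\pi \mathrm{i}/d}$, $\omega^t:=e^{2\pi \mathrm{i}t/d}$ for real $t$, and $a_k=\frac{1-\mathrm{i}}{2}e^{\pi \mathrm{i}k/(2d)}$. A strategy consists of a dimension $D\ge 1$ and four $d$-outcome measurements $A_1,\dots,A_4$ on $\mathbb{C}^D$, where $A_i$ is given by one Kraus operator $K_i^{a}$ for each outcome $a\in\{0,\dots,d-1\}$, with $\sum_a (K_i^a)^\dagger K_i^a=\mathbb{1}$. When $A_i$ is measured on the maximally mixed state $\mathbb{1}/D$ and $A_j$ is then measured on the post-measurement state, the statistics are $$p(a|A_i)=\tfrac1D\operatorname{Tr}[K_i^a (K_i^a)^\dagger],\quad p(a,b|A_i,A_j)=\tfrac1D\operatorname{Tr}[K_j^bK_i^a (K_i^a)^\dagger (K_j^b)^\dagger],\quad p(b|A_i,A_j,a)=\frac{p(a,b|A_i,A_j)}{p(a|A_i)}.$$ Put $\langle A_i^kA_j^l\rangle=\sum_{a,b=0}^{d-1}\omega^{ak+bl}\,p(a,b|A_i,A_j)$ and $$\tau_d=\sum_{k=1}^{d-1}\Big[a_k\langle A_1^kA_3^{d-k}\rangle+a_k^*\omega^k\langle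 A_1^kA_4^{d-k}\rangle+a_k^*\langle A_2^kA_3^{d-k}\rangle+a_k\langle A_2^kA_4^{d-k}\rangle$$ $$\qquad\qquad+a_k\langle A_3^{d-k}A_1^k\rangle+a_k^*\omega^k\langle A_4^{d-k}A_1^k\rangle+a_k^*\langle A_3^{d-k}A_2^k\rangle+a_k\langle A_4^{d-k}A_2^k\rangle\Big].$$ Let $\mathcal S$ be the set of all strategies (of any dimension $D$) such that $p(a,a|A_i,A_i)=p(a|A_i)$ for all $i$ and all $a$ (projectivity condition) and $\tau_d=4(d-1)$ (maximal violation). The certified randomness of the second outcome is $$\mathcal H(A_i,A_j)=\min_{\mathcal S}\Big[-\sum_{a=0}^{d-1}p(a|A_i)\sum_{b=0}^{d-1}p(b|A_i,A_j,a)\log_2 p(b|A_i,A_j,a)\Big],$$ with the conventions that $0\log_2 0=0$ and that terms with $p(a|A_i)=0$ vanish. Let $Z_d=\sum_{q}\omega^q|q\rangle\langle q|$, $T_d=\sum_{q}\omega^{q+1/2}|q\rangle\langle q|-\frac2d\sum_{q,r}(-1)^{\delta_{q,0}+\delta_{r,0}}\omega^{(q+r+1)/2}|q\rangle\langle r|$,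 $M_d=a_1Z_d+a_1^*T_d$ and $N_d=\omega a_1^*Z_d+a_1T_d$ on $\mathbb{C}^d$ (sums over $0\le q,r\le d-1$). Then: 1. For all $i,j\in\{1,2,3,4\}$ the minimum exists, and every strategy in $\mathcal S$ attains it. 2. Each of $Z_d,T_d,M_d,N_d$ has, for every $a\in\{0,\dots,d-1\}$, a normalized eigenvector with eigenvalue $\omega^a$. For any choice of such eigenvectors, written $|A_1^a\rangle,|A_2^a\rangle,|A_3^a\rangle,|A_4^a\rangle$ respectively, one has for all $i,j$ and every $a$ $$\mathcal H(A_i,A_j)=-\sum_{b=0}^{d-1}\big|\langle A_i^{a}|A_j^{b}\rangle\big|^2\log_2\big|\langle A_i^{a}|A_j^{b}\rangle\big|^2,$$ and $\big|\langle A_1^{a}|A_2^{b}\rangle\big|^2=\frac{4}{d^2}\,\big|1-\omega^{b-a-1/2}\big|^{-2}$ for all $a,b$. 3. $\mathcal H(A_i,A_i)=0$ for every $i$. 4. $$\mathcal H(A_1,A_2)=\mathcal H(A_2,A_1)=\mathcal H(A_3,A_4)=\mathcal H(A_4,A_3)=-\sum_{x=0}^{d-1}\frac{4}{d^2}\frac{1}{|1-\omega^{x-1/2}|^{2}}\log_2\!\left[\frac{4}{d^2}\frac{1}{|1-\omega^{x-1/2}|^{2}}\right].$$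 -/

import Mathlib

open scoped Matrix

noncomputable section

namespace TemporalRandomness

/-- The power `ω ^ t` of `ω = exp (2 π i / d)` for a real exponent `t`,
with the convention `ω ^ t = exp (2 π i t / d)`. -/
def omegaPow (d : ℕ) (t : ℝ) : ℂ :=
  Complex.exp (2 * Real.pi * Complex.I * t / d)

/-- A measurement with outcomes `0, …, d - 1` on `ℂ^D`, with one Kraus operator per outcome.
The POVM element of the outcome `a` is `(kraus a)ᴴ * kraus a`; by polar decomposition a
Kraus operator with POVM element `M` is the same thing as `U * √M` with `U` unitary. -/
structure Measurement (d D : ℕ) where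
  kraus : Fin d → Matrix (Fin D) (Fin D) ℂ
  complete : ∑ a, (kraus a)ᴴ * kraus a = 1

/-- Four measurements `A_1, A_2, A_3, A_4`; the index `i : Fin 4` stands for `A_{i+1}`. -/
abbrev Strategy (d D : ℕ) : Type := Fin 4 → Measurement d D

/-- The maximally mixed state `𝟙 / D`. -/
def maximallyMixed (D : ℕ) : Matrix (Fin D) (Fin D) ℂ := (D : ℂ)⁻¹ • 1

variable {d D : ℕ}

/-- The unnormalized state after the outcome `a` of `A` on the maximally mixed state. -/
def postState (A : Measurement d D) (a : Fin d) : Matrix (Fin D) (Fin D) ℂ :=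
  A.kraus a * maximallyMixed D * (A.kraus a)ᴴ

/-- `p(a | A)`: the probability of the outcome `a` of `A` on the maximally mixed state. -/
def prob (A : Measurement d D) (a : Fin d) : ℝ :=
  (Matrix.trace (postState A a)).re

/-- `p(a, b | A, B)`: the probability of the outcome `a` when `A` is measured on the maximally
mixed state and of the outcome `b` when `B` is then measured on the post-measurement state. -/
def jointProb (A B : Measurement d D) (a b : Fin d) : ℝ :=
  (Matrix.trace (B.kraus b * postState A a * (B.kraus b)ᴴ)).re

/-- `p(a | A)` is the marginal of `p(a, b | A, B)`, for every second measurement `B`. -/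
theorem sum_jointProb (A B : Measurement d D) (a : Fin d) :
    ∑ b, jointProb A B a b = prob A a := by
  unfold jointProb prob
  rw [← Complex.re_sum, ← Matrix.trace_sum]
  have h : ∀ b, Matrix.trace (B.kraus b * postState A a * (B.kraus b)ᴴ)
      = Matrix.trace ((B.kraus b)ᴴ * B.kraus b * postState A a) := fun b => by
    rw [Matrix.trace_mul_comm, Matrix.mul_assoc]
  rw [Matrix.trace_sum, Finset.sum_congr rfl fun b _ => h b, ← Matrix.trace_sum,
    ← Finset.sum_mul, B.complete, Matrix.one_mul]

/-- `p(b | A, B, a) = p(a, b | A, B) / p(a | A)`. -/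
def condProb (A B : Measurement d D) (a b : Fin d) : ℝ :=
  jointProb A B a b / prob A a

/-- The projectivity condition `p(a, a | A, A) = p(a | A)` for all outcomes `a`. -/
def IsRepeatable (A : Measurement d D) : Prop :=
  ∀ a, jointProb A A a a = prob A a

/-- `⟨A^(k) B^(l)⟩ = ∑_{a,b} ω^{a k + b l} p(a, b | A, B)`, where `A` is measured first. -/
def correlator (A B : Measurement d D) (k l : ℕ) : ℂ :=
  ∑ a : Fin d, ∑ b : Fin d,
    omegaPow d ((a : ℝ) * k + (b : ℝ) * l) * (jointProb A B a b : ℂ)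

/-- `a_k = ((1 - i) / 2) exp (π i k / (2 d))`. -/
def coeff (d k : ℕ) : ℂ :=
  (1 - Complex.I) / 2 * Complex.exp (Real.pi * Complex.I * k / (2 * d))

open scoped ComplexConjugate in
/-- The temporal expression `τ_d`. -/
def temporalValue (A : Strategy d D) : ℂ :=
  ∑ k ∈ Finset.Icc 1 (d - 1),
    (coeff d k * correlator (A 0) (A 2) k (d - k)
      + conj (coeff d k) * omegaPow d k * correlator (A 0) (A 3) k (d - k)
      + conj (coeff d k) * correlator (A 1) (A 2) k (d - k)
      + coeff d k * correlator (A 1) (A 3) k (d - k)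
      + coeff d k * correlator (A 2) (A 0) (d - k) k
      + conj (coeff d k) * omegaPow d k * correlator (A 3) (A 0) (d - k) k
      + conj (coeff d k) * correlator (A 2) (A 1) (d - k) k
      + coeff d k * correlator (A 3) (A 1) (d - k) k)

/-- The admissible strategies: all four measurements satisfy the projectivity condition,
and the temporal expression takes its maximal quantum value `4 (d - 1)`. -/
structure IsOptimal (A : Strategy d D) : Prop where
  dim_pos : 0 < D
  repeatable : ∀ i, IsRepeatable (A i)
  value : temporalValue A = 4 * ((d : ℂ) - 1)

/-- The Shannon entropy (in bits) of the outcome of the second measurement `B`, given the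
outcome of the first measurement `A`, averaged over the latter. -/
def outcomeEntropy (A B : Measurement d D) : ℝ :=
  -∑ a, prob A a * ∑ b, condProb A B a b * Real.logb 2 (condProb A B a b)

/-- The values of the averaged entropy over all admissible strategies, in all dimensions. -/
def strategyEntropies (d : ℕ) (i j : Fin 4) : Set ℝ :=
  {h | ∃ (D : ℕ) (A : Strategy d D), IsOptimal A ∧ h = outcomeEntropy (A i) (A j)}

/-- The certified randomness `H(A_i, A_j)`: the minimum of the averaged entropy over all
admissible strategies. -/
def certifiedRandomness (d : ℕ) (i j : Fin 4) : ℝ :=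
  sInf (strategyEntropies d i j)

/-- `Z_d = ∑ ω^i |i⟩⟨i|`. -/
def obsZ (d : ℕ) : Matrix (Fin d) (Fin d) ℂ :=
  Matrix.diagonal fun i => omegaPow d (i : ℝ)

/-- `T_d = ∑ ω^{i+1/2} |i⟩⟨i| - (2/d) ∑ (-1)^{δ_{i,0} + δ_{j,0}} ω^{(i+j+1)/2} |i⟩⟨j|`. -/
def obsT (d : ℕ) : Matrix (Fin d) (Fin d) ℂ :=
  Matrix.diagonal (fun i : Fin d => omegaPow d ((i : ℝ) + 1 / 2))
    - (2 / (d : ℂ)) • Matrix.of fun i j : Fin d =>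
        (if (i : ℕ) = 0 then (-1 : ℂ) else 1) * (if (j : ℕ) = 0 then (-1 : ℂ) else 1)
          * omegaPow d (((i : ℝ) + (j : ℝ) + 1) / 2)

open scoped ComplexConjugate in
/-- The `d`-dimensional observables `Z_d`, `T_d`, `M_d = a_1 Z_d + a_1^* T_d` and
`N_d = ω a_1^* Z_d + a_1 T_d` that correspond to `A_1, A_2, A_3, A_4`. -/
def refObs (d : ℕ) : Fin 4 → Matrix (Fin d) (Fin d) ℂ :=
  ![obsZ d,
    obsT d,
    coeff d 1 • obsZ d + conj (coeff d 1) • obsT d,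
    (omegaPow d 1 * conj (coeff d 1)) • obsZ d + coeff d 1 • obsT d]

/-- `v i a` is a normalized eigenvector of the `i`-th observable with eigenvalue `ω^a`. -/
def IsEigenstateFamily (v : Fin 4 → Fin d → EuclideanSpace ℂ (Fin d)) : Prop :=
  ∀ i a, ‖v i a‖ = 1 ∧
    Matrix.toEuclideanLin (refObs d i) (v i a) = omegaPow d (a : ℝ) • v i a

/-- `|⟨u | v⟩|²`. -/
def overlap (u v : EuclideanSpace ℂ (Fin d)) : ℝ := ‖inner ℂ u v‖ ^ 2

/-- `(4 / d²) |1 - ω^t|⁻²`. -/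
def closedFormProb (d : ℕ) (t : ℝ) : ℝ :=
  4 / (d : ℝ) ^ 2 * (1 / ‖1 - omegaPow d t‖ ^ 2)

/-- `- ∑_x (4 / d²) |1 - ω^{x - 1/2}|⁻² log₂ [(4 / d²) |1 - ω^{x - 1/2}|⁻²]`. -/
def closedFormEntropy (d : ℕ) : ℝ :=
  -∑ x ∈ Finset.range d,
    closedFormProb d ((x : ℝ) - 1 / 2) * Real.logb 2 (closedFormProb d ((x : ℝ) - 1 / 2))

end TemporalRandomness

end

open scoped Matrix

noncomputable section

namespace TemporalRandomness

open Finset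

/-! Every optimal strategy has the same joint distributions, so the set over which the minimum is
taken yields a single entropy value. Uniqueness up to isometry is not needed: only traces of
products of powers of the observables enter.

Repeatability on the maximally mixed state forces the POVM elements to be orthogonal projections,
and then `p(a, b) = Tr[E_a E_b] / D`. With the unitaries `U_i = ∑ ω^a E_a` of order `d`, the defect
`4 (d - 1) - τ_d` becomes a sum of squared Hilbert–Schmidt norms (`sum_defect`). Maximal violation
therefore means `U_3^k = a_k U_1^k + a_k^* U_2^k` and `U_4^k = a_k^* ω^k U_1^k + a_k U_2^k` for `0 <
k < d` (`IsOptimal.combinations`).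

Write `A = U_1`, `μ = quarterRoot d` and `U_2^k A⁻ᵏ = μ^(2k) (1 - 2 Q_k)`; then `U_3^k A⁻ᵏ = μ^k (1
- (1 + i) Q_k)` with the same `Q_k`. Multiplicativity in `k`, compared for the two coefficients `2`
and `1 + i`, gives `Q_k = ∑_{j<k} A^j R A⁻ʲ` with `R = Q_1`, `R A^j R = 0` for `0 < j < d`, and `Q_d
= 1` (`isShiftResolution_of_pow_eq`). These relations fix all traces `Tr[U_i^k U_j^l]` up to the
factor `D` (`trace_correlation`), and Fourier inversion fixes the distributions
(`jointProb_eq_profile`).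

The matrices `Z_d, T_d, M_d, N_d` arise from a rank-one `R` on `ℂ^d`. They give an optimal strategy
with spectral projections of trace one, so overlaps of eigenvectors are the conditional
probabilities. The closed form is an arithmetic-geometric sum (`sum_pow_mul_one_sub`). -/

/-! ### The root of unity `exp (π i / (2 d))` -/

/-- `exp (π i / (2 d))`, a fourth root of `ω`. -/
def quarterRoot (d : ℕ) : ℂ := Complex.exp (Real.pi * Complex.I / (2 * d))

theorem quarterRoot_ne_zero (d : ℕ) : quarterRoot d ≠ 0 := Complex.exp_ne_zero _

theorem norm_quarterRoot (d : ℕ) : ‖quarterRoot d‖ = 1 := by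
  have : (Real.pi * Complex.I / (2 * d) : ℂ) = ((Real.pi / (2 * d) : ℝ) : ℂ) * Complex.I := by
    push_cast; ring
  rw [quarterRoot, this, Complex.norm_exp_ofReal_mul_I]

theorem conj_quarterRoot (d : ℕ) : (starRingEnd ℂ) (quarterRoot d) = (quarterRoot d)⁻¹ :=
  (Complex.inv_eq_conj (norm_quarterRoot d)).symm

theorem quarterRoot_pow_self {d : ℕ} (hd : d ≠ 0) : quarterRoot d ^ d = Complex.I := by
  have h : (d : ℂ) ≠ 0 := Nat.cast_ne_zero.2 hd
  rw [quarterRoot, ← Complex.exp_nat_mul]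
  refine Eq.trans (congrArg Complex.exp ?_) Complex.exp_pi_div_two_mul_I
  field_simp

theorem omegaPow_add (d : ℕ) (s t : ℝ) : omegaPow d (s + t) = omegaPow d s * omegaPow d t := by
  rw [omegaPow, omegaPow, omegaPow, ← Complex.exp_add]
  congr 1
  push_cast
  ring

theorem norm_omegaPow (d : ℕ) (t : ℝ) : ‖omegaPow d t‖ = 1 := by
  have : (2 * Real.pi * Complex.I * t / d : ℂ) = ((2 * Real.pi * t / d : ℝ) : ℂ) * Complex.I := by
    push_cast; ring
  rw [omegaPow, this, Complex.norm_exp_ofReal_mul_I]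

theorem omegaPow_ne_zero (d : ℕ) (t : ℝ) : omegaPow d t ≠ 0 := Complex.exp_ne_zero _

theorem omegaPow_neg (d : ℕ) (t : ℝ) : omegaPow d (-t) = (omegaPow d t)⁻¹ := by
  rw [omegaPow, omegaPow, ← Complex.exp_neg]
  congr 1
  push_cast
  ring

theorem conj_omegaPow (d : ℕ) (t : ℝ) :
    (starRingEnd ℂ) (omegaPow d t) = (omegaPow d t)⁻¹ :=
  (Complex.inv_eq_conj (norm_omegaPow d t)).symm

theorem omegaPow_natCast_mul (d n : ℕ) (t : ℝ) : omegaPow d (n * t) = omegaPow d t ^ n := by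
  rw [omegaPow, omegaPow, ← Complex.exp_nat_mul]
  congr 1
  push_cast
  ring

theorem omegaPow_natCast (d n : ℕ) : omegaPow d n = omegaPow d 1 ^ n := by
  rw [← omegaPow_natCast_mul, mul_one]

theorem omegaPow_one (d : ℕ) : omegaPow d 1 = quarterRoot d ^ 4 := by
  rw [omegaPow, quarterRoot, ← Complex.exp_nat_mul]
  congr 1
  push_cast
  ring

theorem omegaPow_half (d : ℕ) : omegaPow d (1 / 2) = quarterRoot d ^ 2 := by
  rw [omegaPow, quarterRoot, ← Complex.exp_nat_mul]
  congr 1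
  push_cast
  ring

theorem isPrimitiveRoot_omegaPow_one {d : ℕ} (hd : d ≠ 0) :
    IsPrimitiveRoot (omegaPow d 1) d := by
  have := Complex.isPrimitiveRoot_exp d hd
  rw [omegaPow]
  simpa using this

theorem omegaPow_natCast_pow_self {d : ℕ} (hd : d ≠ 0) (n : ℕ) : omegaPow d n ^ d = 1 := by
  rw [omegaPow_natCast, ← pow_mul, mul_comm, pow_mul,
    (isPrimitiveRoot_omegaPow_one hd).pow_eq_one, one_pow]

theorem omegaPow_self {d : ℕ} (hd : d ≠ 0) : omegaPow d d = 1 := by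
  rw [omegaPow_natCast, (isPrimitiveRoot_omegaPow_one hd).pow_eq_one]

theorem coeff_eq (d k : ℕ) : coeff d k = (1 - Complex.I) / 2 * quarterRoot d ^ k := by
  rw [coeff, quarterRoot, ← Complex.exp_nat_mul]
  congr 2
  ring

theorem conj_coeff (d k : ℕ) :
    (starRingEnd ℂ) (coeff d k) = (1 + Complex.I) / 2 * (quarterRoot d ^ k)⁻¹ := by
  rw [coeff_eq]
  simp only [map_mul, map_div₀, map_sub, map_one, map_pow, Complex.conj_I, map_ofNat,
    conj_quarterRoot, inv_pow, sub_neg_eq_add]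

/-- Orthogonality of the characters of `ℤ / d`, summed over the exponent. -/
theorem sum_range_inv_mul_pow {d : ℕ} (a b : Fin d) :
    ∑ k ∈ range d, ((omegaPow d (a : ℕ))⁻¹ * omegaPow d (b : ℕ)) ^ k
      = if a = b then (d : ℂ) else 0 := by
  have hd : d ≠ 0 := (Fin.pos a).ne'
  split_ifs with h
  · subst h
    simp [inv_mul_cancel₀ (omegaPow_ne_zero d _)]
  · have h1 : (omegaPow d (a : ℕ))⁻¹ * omegaPow d (b : ℕ) ≠ 1 := by
      intro h2
      apply h
      rw [inv_mul_eq_one₀ (omegaPow_ne_zero d _), omegaPow_natCast, omegaPow_natCast] at h2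
      exact Fin.ext ((isPrimitiveRoot_omegaPow_one hd).pow_inj a.2 b.2 h2)
    rw [geom_sum_eq h1, mul_pow, inv_pow, omegaPow_natCast_pow_self hd,
      omegaPow_natCast_pow_self hd]
    simp

theorem sum_fin_inv_pow {d : ℕ} {k : ℕ} (hk : k < d) :
    ∑ a : Fin d, (omegaPow d (a : ℕ))⁻¹ ^ k = if k = 0 then (d : ℂ) else 0 := by
  have hd : 0 < d := by omega
  have h := sum_range_inv_mul_pow (⟨k, hk⟩ : Fin d) ⟨0, hd⟩
  have h0 : omegaPow d ((0 : ℕ) : ℝ) = 1 := by simp [omegaPow]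
  simp only [h0, mul_one, Fin.mk.injEq] at h
  rw [← h, ← Fin.sum_univ_eq_sum_range (fun j => (omegaPow d k)⁻¹ ^ j)]
  refine sum_congr rfl fun a _ => ?_
  rw [omegaPow_natCast, omegaPow_natCast, inv_pow, inv_pow, ← pow_mul, ← pow_mul, mul_comm]

theorem sum_fin_pow {d : ℕ} {k : ℕ} (hk : k < d) :
    ∑ a : Fin d, omegaPow d (a : ℕ) ^ k = if k = 0 then (d : ℂ) else 0 := by
  have h := congrArg (starRingEnd ℂ) (sum_fin_inv_pow hk)
  simp only [map_sum, map_pow, map_inv₀, conj_omegaPow, inv_inv] at h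
  rw [h]
  split_ifs <;> simp

/-! ### Shift resolutions of the identity -/

section ShiftResolution

variable {n : Type*} [Fintype n] [DecidableEq n]

/-- The sum over `j < k` of the translates `A^j R A⁻ʲ`, with the inverse of `A` as a separate
argument. -/
def shiftSum (A A' R : Matrix n n ℂ) (k : ℕ) : Matrix n n ℂ :=
  ∑ j ∈ range k, A ^ j * R * A' ^ j

/-- The term `j = 0` is split off rather than the last one, which matches the recursion satisfied by
powers of the observables. -/
theorem shiftSum_succ (A A' R : Matrix n n ℂ) (k : ℕ) :
    shiftSum A A' R (k + 1) = R + A * shiftSum A A' R k * A' := by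
  rw [shiftSum, sum_range_succ', shiftSum, mul_sum, sum_mul, add_comm]
  congr 1
  · simp
  · refine sum_congr rfl fun j _ => ?_
    rw [pow_succ', pow_succ]
    simp only [mul_assoc]

/-- The translates `A^j R A⁻ʲ`, `0 ≤ j < d`, of `R` under a matrix `A` of order `d`
are mutually orthogonal and sum up to the identity. -/
structure IsShiftResolution (d : ℕ) (A A' R : Matrix n n ℂ) : Prop where
  mul_inv : A * A' = 1
  inv_mul : A' * A = 1
  pow_order : A ^ d = 1
  orthogonal : ∀ j, 0 < j → j < d → R * A ^ j * R = 0
  total : shiftSum A A' R d = 1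

namespace IsShiftResolution

variable {d : ℕ} {A A' R : Matrix n n ℂ}

theorem inv_pow_mul_pow (h : IsShiftResolution d A A' R) (j : ℕ) : A' ^ j * A ^ j = 1 := by
  induction j with
  | zero => simp
  | succ j ih =>
    rw [pow_succ, pow_succ', mul_assoc, ← mul_assoc A', h.inv_mul, one_mul, ih]

theorem inv_pow_mul_pow_of_le (h : IsShiftResolution d A A' R) {i k : ℕ} (hik : i ≤ k) :
    A' ^ i * A ^ k = A ^ (k - i) := by
  obtain ⟨m, rfl⟩ := Nat.exists_eq_add_of_le hik
  rw [pow_add, ← mul_assoc, h.inv_pow_mul_pow, one_mul, Nat.add_sub_cancel_left]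

theorem mul_shiftSum_eq_zero (h : IsShiftResolution d A A' R) {k : ℕ} (hk : k < d) :
    R * (A * shiftSum A A' R k * A') = 0 := by
  rw [shiftSum, mul_sum, sum_mul, mul_sum]
  refine sum_eq_zero fun j hj => ?_
  have hj' := mem_range.1 hj
  have := h.orthogonal (j + 1) (by omega) (by omega)
  rw [pow_succ'] at this
  calc R * (A * (A ^ j * R * A' ^ j) * A') = R * (A * A ^ j) * R * (A' ^ j * A') := by
        simp only [mul_assoc]
    _ = 0 := by rw [this, zero_mul]

/-- Multiply `1 = R + A S A'` by `R` on the left, where `S` is the sum of the first `d - 1`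
translates; orthogonality kills the second term. -/
theorem idempotent (h : IsShiftResolution d A A' R) (hd : d ≠ 0) : R * R = R := by
  obtain ⟨m, rfl⟩ := Nat.exists_eq_succ_of_ne_zero hd
  have h1 := h.total
  rw [Nat.succ_eq_add_one, shiftSum_succ] at h1
  have h2 := congrArg (R * ·) h1
  simpa [mul_add, h.mul_shiftSum_eq_zero (Nat.lt_succ_self m)] using h2

/-- Powers of the observables `p (1 - c R) A`. -/
theorem smul_mul_pow (h : IsShiftResolution d A A' R) (p c : ℂ) {k : ℕ} (hk : k ≤ d) :
    (p • ((1 - c • R) * A)) ^ k = p ^ k • ((1 - c • shiftSum A A' R k) * A ^ k) := by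
  induction k with
  | zero => simp [shiftSum]
  | succ k ih =>
    have h1 : A * shiftSum A A' R k = A * shiftSum A A' R k * A' * A := by
      rw [mul_assoc _ A' A, h.inv_mul, mul_one]
    -- The cross term, quadratic in `c`, vanishes, so the powers stay affine in `c`.
    have h2 := h.mul_shiftSum_eq_zero (k := k) (by omega)
    have h3 : (1 - c • R) * A * ((1 - c • shiftSum A A' R k) * A ^ k)
        = (1 - c • shiftSum A A' R (k + 1)) * A ^ (k + 1) := by
      calc (1 - c • R) * A * ((1 - c • shiftSum A A' R k) * A ^ k)
          = (1 - c • R) * ((A - c • (A * shiftSum A A' R k)) * A ^ k) := by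
            rw [mul_assoc, ← mul_assoc A, mul_sub, mul_one, mul_smul_comm]
        _ = (1 - c • R) * ((1 - c • (A * shiftSum A A' R k * A')) * A ^ (k + 1)) := by
            congr 1
            rw [pow_succ', ← mul_assoc, sub_mul 1, one_mul, smul_mul_assoc, ← h1]
        _ = (1 - c • shiftSum A A' R (k + 1)) * A ^ (k + 1) := by
            rw [← mul_assoc]
            congr 1
            rw [shiftSum_succ, sub_mul, one_mul, mul_sub, mul_one, smul_mul_assoc,
              mul_smul_comm, h2]
            module
    rw [pow_succ', ih (by omega), smul_mul_smul_comm, h3, pow_succ' p]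

theorem trace_translate (h : IsShiftResolution d A A' R) (j m : ℕ) :
    (A ^ j * R * A' ^ j * A ^ m).trace = (R * A ^ m).trace := by
  rw [mul_assoc, mul_assoc, Matrix.trace_mul_comm, mul_assoc]
  congr 2
  rw [mul_assoc, ← pow_add, add_comm, pow_add, ← mul_assoc, h.inv_pow_mul_pow, one_mul]

theorem trace_shiftSum_mul (h : IsShiftResolution d A A' R) (k m : ℕ) :
    (shiftSum A A' R k * A ^ m).trace = k * (R * A ^ m).trace := by
  rw [shiftSum, sum_mul, Matrix.trace_sum, sum_congr rfl fun j _ => h.trace_translate j m]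
  simp

/-- Exponents up to `2 d` occur because two powers below `d` get multiplied; `p = d` is excluded
since `R A^d R = R`. -/
theorem mul_pow_mul_eq_zero (h : IsShiftResolution d A A' R) {p : ℕ} (hp : 0 < p)
    (hp2 : p < 2 * d) (hpd : p ≠ d) : R * A ^ p * R = 0 := by
  rcases lt_or_gt_of_ne hpd with hlt | hlt
  · exact h.orthogonal p hp hlt
  · have : A ^ p = A ^ (p - d) := by
      conv_lhs => rw [← Nat.sub_add_cancel hlt.le, pow_add, h.pow_order, mul_one]
    rw [this]
    exact h.orthogonal _ (by omega) (by omega)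

/-- All `d` translates of `R` have the same trace and sum to `1`. If `d ∤ m`, then `Tr[R A^m] = Tr[R
A^m R] = 0`. -/
theorem trace_mul_pow (h : IsShiftResolution d A A' R) {m : ℕ} (hm : m < 2 * d) :
    (R * A ^ m).trace = if d ∣ m then (Fintype.card n : ℂ) / d else 0 := by
  have hd : d ≠ 0 := by omega
  have hR : R.trace = (Fintype.card n : ℂ) / d := by
    have h1 := h.trace_shiftSum_mul d 0
    rw [h.total] at h1
    simp only [pow_zero, mul_one, Matrix.trace_one] at h1
    rw [h1, mul_div_cancel_left₀]
    exact Nat.cast_ne_zero.2 hd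
  split_ifs with hdm
  · obtain ⟨q, rfl⟩ := hdm
    rw [pow_mul, h.pow_order, one_pow, mul_one, hR]
  · have h0 : 0 < m := Nat.pos_of_ne_zero (by rintro rfl; simp at hdm)
    have hne : m ≠ d := by rintro rfl; simp at hdm
    rw [← h.idempotent hd, mul_assoc, Matrix.trace_mul_comm, h.mul_pow_mul_eq_zero h0 hm hne,
      Matrix.trace_zero]

/-- At most one of `p`, `q` can equal `d`, and by cyclicity the other one already makes the trace
vanish. -/
theorem trace_mul_pow_mul_mul_pow (h : IsShiftResolution d A A' R) {p q : ℕ} (hp : 0 < p)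
    (hq : 0 < q) (hpq : p + q < 2 * d) : (R * A ^ p * (R * A ^ q)).trace = 0 := by
  by_cases hpd : p = d
  · rw [Matrix.trace_mul_comm, ← mul_assoc, h.mul_pow_mul_eq_zero hq (by omega) (by omega)]
    simp
  · rw [← mul_assoc, h.mul_pow_mul_eq_zero hp (by omega) hpd]
    simp

theorem trace_shiftSum_mul_shiftSum (h : IsShiftResolution d A A' R) {k l : ℕ} (hk : k < d)
    (hl : l < d) :
    (shiftSum A A' R k * A ^ k * (shiftSum A A' R l * A ^ l)).trace = 0 := by
  rw [shiftSum, shiftSum, sum_mul, sum_mul, sum_mul, Matrix.trace_sum]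
  refine sum_eq_zero fun i hi => ?_
  rw [mul_sum, Matrix.trace_sum]
  refine sum_eq_zero fun j hj => ?_
  have hi' := mem_range.1 hi
  have hj' := mem_range.1 hj
  -- After a cyclic rotation the exponents between the two copies of `R` are `k - i + j` and `l - j
  -- + i`: both positive, with sum `k + l < 2 d`.
  have e : A ^ i * R * A' ^ i * A ^ k * (A ^ j * R * A' ^ j * A ^ l)
      = A ^ i * (R * A ^ (k - i + j) * (R * A ^ (l - j))) := by
    rw [← h.inv_pow_mul_pow_of_le hj'.le, pow_add, ← h.inv_pow_mul_pow_of_le hi'.le]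
    simp only [mul_assoc]
  rw [e, Matrix.trace_mul_comm, mul_assoc, mul_assoc R (A ^ (l - j)), ← pow_add,
    h.trace_mul_pow_mul_mul_pow (by omega) (by omega) (by omega)]

/-- Correlations of the observables built from a shift resolution. -/
theorem trace_correlation (h : IsShiftResolution d A A' R) (c c' : ℂ) {k l : ℕ} (hk : k < d)
    (hl : l < d) :
    ((1 - c • shiftSum A A' R k) * A ^ k * ((1 - c' • shiftSum A A' R l) * A ^ l)).trace
      = (d - c * k - c' * l) * if d ∣ k + l then (Fintype.card n : ℂ) / d else 0 := by
  have e : (1 - c • shiftSum A A' R k) * A ^ k * ((1 - c' • shiftSum A A' R l) * A ^ l)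
      = A ^ (k + l) - c • (shiftSum A A' R k * A ^ (k + l))
        - c' • (A ^ k * (shiftSum A A' R l * A ^ l))
        + (c * c') • (shiftSum A A' R k * A ^ k * (shiftSum A A' R l * A ^ l)) := by
    simp only [sub_mul, mul_sub, one_mul, smul_mul_assoc, mul_smul_comm, pow_add, mul_assoc]
    module
  have e2 : (A ^ k * (shiftSum A A' R l * A ^ l)).trace = l * (R * A ^ (k + l)).trace := by
    rw [Matrix.trace_mul_comm, mul_assoc, ← pow_add, add_comm l k, h.trace_shiftSum_mul]
  have e3 : (A ^ (k + l)).trace = d * (R * A ^ (k + l)).trace := by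
    rw [← h.trace_shiftSum_mul, h.total, one_mul]
  rw [e, Matrix.trace_add, Matrix.trace_sub, Matrix.trace_sub, Matrix.trace_smul,
    Matrix.trace_smul, Matrix.trace_smul, e2, e3, h.trace_shiftSum_mul,
    h.trace_shiftSum_mul_shiftSum hk hl, ← h.trace_mul_pow (by omega : k + l < 2 * d)]
  simp only [smul_eq_mul]
  ring

end IsShiftResolution

end ShiftResolution

section
variable {n : Type*} [Fintype n] [DecidableEq n]

/-! ### A shift resolution from power relations -/

/-- Matrices `A`, `B`, `C` of order `d` with `C ^ k = a_k A ^ k + a_k^* B ^ k` for `0 < k < d`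
come from a shift resolution of the identity. -/
theorem isShiftResolution_of_pow_eq {d : ℕ} (hd : d ≠ 0) {A A' B C : Matrix n n ℂ}
    (hAA' : A * A' = 1) (hA'A : A' * A = 1) (hA : A ^ d = 1) (hB : B ^ d = 1) (hC : C ^ d = 1)
    (hrel : ∀ k, 0 < k → k < d →
      C ^ k = coeff d k • A ^ k + (starRingEnd ℂ) (coeff d k) • B ^ k) :
    ∃ R, IsShiftResolution d A A' R ∧ ∀ k ≤ d, B ^ k
      = (quarterRoot d ^ 2) ^ k • ((1 - (2 : ℂ) • shiftSum A A' R k) * A ^ k) := by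
  set μ := quarterRoot d with hμ
  have hμ0 : μ ≠ 0 := quarterRoot_ne_zero d
  have hμd : μ ^ d = Complex.I := quarterRoot_pow_self hd
  have hI : Complex.I * Complex.I = -1 := Complex.I_mul_I
  have cancel : ∀ j, A ^ j * A' ^ j = 1 := fun j => by
    induction j with
    | zero => simp
    | succ j ih => rw [pow_succ, pow_succ', mul_assoc, ← mul_assoc A, hAA', one_mul, ih]
  have cancel' : ∀ j, A' ^ j * A ^ j = 1 := fun j => by
    induction j with
    | zero => simp
    | succ j ih => rw [pow_succ, pow_succ', mul_assoc, ← mul_assoc A', hA'A, one_mul, ih]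
  have hA'd : A' ^ d = 1 := by simpa [hA] using cancel d
  -- `Q k` is what `B^k A⁻ᵏ = μ^(2k) (1 - 2 Q k)` dictates. The relation for `C^k` then involves the
  -- same `Q k`, with `1 + i` in place of `2`.
  let Q : ℕ → Matrix n n ℂ := fun k => (1 / 2 : ℂ) • (1 - ((μ ^ 2) ^ k)⁻¹ • (B ^ k * A' ^ k))
  have hBQ : ∀ k, B ^ k * A' ^ k = (μ ^ 2) ^ k • (1 - (2 : ℂ) • Q k) := fun k => by
    have h0 : (μ ^ 2) ^ k ≠ 0 := pow_ne_zero _ (pow_ne_zero _ hμ0)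
    simp only [Q, smul_smul]
    rw [show (2 : ℂ) * (1 / 2) = 1 by norm_num, one_smul, sub_sub_cancel, smul_smul,
      mul_inv_cancel₀ h0, one_smul]
  have hCQ : ∀ k ≤ d, C ^ k * A' ^ k = μ ^ k • (1 - (1 + Complex.I) • Q k) := fun k hk => by
    rcases Nat.eq_zero_or_pos k with rfl | hk0
    · simp [Q]
    rcases hk.lt_or_eq with hlt | rfl
    · have h0 : μ ^ k ≠ 0 := pow_ne_zero _ hμ0
      rw [hrel k hk0 hlt, add_mul, smul_mul_assoc, smul_mul_assoc, cancel, hBQ, conj_coeff,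
        coeff_eq, ← hμ, smul_smul]
      have e : (1 + Complex.I) / 2 * (μ ^ k)⁻¹ * (μ ^ 2) ^ k = (1 + Complex.I) / 2 * μ ^ k := by
        rw [← pow_mul, mul_comm 2 k, pow_mul]
        field_simp
      rw [e]
      module
    -- The relation is not assumed at `k = d`; there `Q d = 1`, and `C^d = 1` agrees because `i (1 -
    -- (1 + i)) = 1`.
    · have h1 : (μ ^ 2) ^ k = -1 := by
        rw [← pow_mul, mul_comm, pow_mul, hμd, Complex.I_sq]
      have h2 : Q k = 1 := by
        simp only [Q, hB, hA'd, h1]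
        rw [mul_one, inv_neg, inv_one, neg_smul, one_smul, sub_neg_eq_add, ← two_smul ℂ,
          smul_smul]
        norm_num
      rw [hC, hA'd, hμd, h2, mul_one]
      have e : Complex.I * (1 - (1 + Complex.I)) = 1 := by linear_combination -hI
      calc (1 : Matrix n n ℂ) = (Complex.I * (1 - (1 + Complex.I))) • 1 := by rw [e, one_smul]
        _ = _ := by module
  have conj_succ : ∀ (X : Matrix n n ℂ) (k : ℕ),
      X ^ (k + 1) * A' ^ (k + 1) = X * A' * (A * (X ^ k * A' ^ k) * A') := fun X k => by
    rw [pow_succ', pow_succ]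
    calc X * X ^ k * (A' ^ k * A') = X * 1 * (X ^ k * (A' ^ k * A')) := by
          simp only [mul_assoc, mul_one]
      _ = _ := by rw [← hA'A]; simp only [mul_assoc]
  have step : ∀ k < d, Q 1 * (A * Q k * A') = 0 ∧ Q (k + 1) = Q 1 + A * Q k * A' := fun k hk => by
    -- Multiplicativity of `X^k` in terms of `Q`, for a general coefficient `c`. Using it for `c =
    -- 2` and `c = 1 + i` separates the part linear in `c` from the quadratic one.
    have key : ∀ (X : Matrix n n ℂ) (p c : ℂ), p ≠ 0 →
        X * A' = p • (1 - c • Q 1) → X ^ k * A' ^ k = p ^ k • (1 - c • Q k) →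
        X ^ (k + 1) * A' ^ (k + 1) = p ^ (k + 1) • (1 - c • Q (k + 1)) →
        c • Q (k + 1) = c • (Q 1 + A * Q k * A') - (c * c) • (Q 1 * (A * Q k * A')) := by
      intro X p c hp h1 hk hk1
      rw [conj_succ, h1, hk] at hk1
      have e : p • (1 - c • Q 1) * (A * (p ^ k • (1 - c • Q k)) * A')
          = p ^ (k + 1) • (1 - c • (Q 1 + A * Q k * A') + (c * c) • (Q 1 * (A * Q k * A'))) := by
        have : A * (p ^ k • (1 - c • Q k)) * A' = p ^ k • (1 - c • (A * Q k * A')) := by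
          rw [mul_smul_comm, smul_mul_assoc, mul_sub, mul_one, sub_mul, hAA', mul_smul_comm,
            smul_mul_assoc]
        rw [this, smul_mul_smul_comm, ← pow_succ']
        congr 1
        simp only [sub_mul, mul_sub, one_mul, mul_one, smul_mul_assoc, mul_smul_comm]
        module
      rw [e] at hk1
      have := smul_right_injective _ (pow_ne_zero (k + 1) hp) hk1
      linear_combination (norm := module) this
    have hb := key B (μ ^ 2) 2 (pow_ne_zero _ hμ0) (by simpa using hBQ 1) (hBQ k) (hBQ (k + 1))
    have hc := key C μ (1 + Complex.I) hμ0 (by simpa using hCQ 1 (by omega)) (hCQ k hk.le)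
      (hCQ (k + 1) hk)
    have hz : Q 1 * (A * Q k * A') = 0 := by
      have e1 : Q (k + 1) = Q 1 + A * Q k * A' - (2 : ℂ) • (Q 1 * (A * Q k * A')) := by
        have := congrArg ((1 / 2 : ℂ) • ·) hb
        simp only [smul_sub, smul_smul] at this
        norm_num at this
        exact this
      rw [e1] at hc
      have e2 : ((1 + Complex.I) * (1 + Complex.I) - (1 + Complex.I) * 2)
          • (Q 1 * (A * Q k * A')) = 0 := by
        rw [smul_sub, smul_smul] at hc
        rw [sub_smul]
        linear_combination (norm := module) hc
      -- Eliminating `Q (k + 1)` leaves the factor `c² - 2c` at `c = 1 + i`, which is nonzero.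
      have e3 : (1 + Complex.I) * (1 + Complex.I) - (1 + Complex.I) * 2 = -2 := by
        linear_combination hI
      rw [e3] at e2
      exact (smul_eq_zero.1 e2).resolve_left (by norm_num)
    refine ⟨hz, ?_⟩
    rw [hz] at hb
    have := congrArg ((1 / 2 : ℂ) • ·) hb
    simp only [smul_sub, smul_smul] at this
    norm_num at this
    exact this
  have hQ : ∀ k ≤ d, Q k = shiftSum A A' (Q 1) k := fun k hk => by
    induction k with
    | zero => simp [Q, shiftSum]
    | succ k ih => rw [(step k hk).2, shiftSum_succ, ← ih (by omega)]
  refine ⟨Q 1, ⟨hAA', hA'A, hA, fun j hj0 hjd => ?_, ?_⟩, fun k hk => ?_⟩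
  · obtain ⟨k, rfl⟩ := Nat.exists_eq_succ_of_ne_zero hj0.ne'
    have h1 := (step (k + 1) (by omega)).1
    have h2 := (step k (by omega)).1
    -- Subtracting the vanishing products for `k` and `k + 1` isolates the single translate `A^k R
    -- A⁻ᵏ`.
    have h3 : Q (k + 1) = Q k + A ^ k * Q 1 * A' ^ k := by
      rw [hQ (k + 1) (by omega), hQ k (by omega), shiftSum, sum_range_succ, ← shiftSum]
    rw [h3, mul_add, add_mul, mul_add, h2, zero_add] at h1
    calc Q 1 * A ^ (k + 1) * Q 1
        = Q 1 * (A * (A ^ k * Q 1 * A' ^ k) * A') * A ^ (k + 1) := by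
          rw [pow_succ' A k]
          simp only [mul_assoc]
          rw [← mul_assoc A' A, hA'A, one_mul, cancel', mul_one]
      _ = 0 := by rw [h1, zero_mul]
  · rw [← hQ d le_rfl]
    have h1 : (μ ^ 2) ^ d = -1 := by
      rw [← pow_mul, mul_comm, pow_mul, hμd, Complex.I_sq]
    simp only [Q, hB, hA'd, h1]
    rw [mul_one, inv_neg, inv_one, neg_smul, one_smul, sub_neg_eq_add, ← two_smul ℂ, smul_smul]
    norm_num
  · rw [← hQ k hk, ← smul_mul_assoc, ← hBQ, mul_assoc, cancel', mul_one]

/-! ### Spectral projections of a unitary matrix of finite order -/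

/-- The projection onto the eigenspace of `U` for the eigenvalue `ω ^ a`, for `U ^ d = 1`. -/
def spectralProj (d : ℕ) (U : Matrix n n ℂ) (a : Fin d) : Matrix n n ℂ :=
  (d : ℂ)⁻¹ • ∑ k ∈ range d, ((omegaPow d (a : ℕ))⁻¹ • U) ^ k

variable {d : ℕ} {U : Matrix n n ℂ}

/-- The geometric sum telescopes, since `(ω⁻ᵃ U)^d = 1`. -/
theorem mul_spectralProj (hU : U ^ d = 1) (a : Fin d) :
    U * spectralProj d U a = omegaPow d (a : ℕ) • spectralProj d U a := by
  have hd : d ≠ 0 := (Fin.pos a).ne'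
  have h := mul_geom_sum ((omegaPow d (a : ℕ))⁻¹ • U) d
  rw [smul_pow, hU, inv_pow, omegaPow_natCast_pow_self hd, inv_one, one_smul, sub_self, sub_mul,
    one_mul, sub_eq_zero, smul_mul_assoc] at h
  have h2 := congrArg (omegaPow d (a : ℕ) • ·) h
  simp only [smul_smul, mul_inv_cancel₀ (omegaPow_ne_zero d _), one_smul] at h2
  rw [spectralProj, mul_smul_comm, h2, smul_comm]

theorem pow_mul_spectralProj (hU : U ^ d = 1) (a : Fin d) (k : ℕ) :
    U ^ k * spectralProj d U a = omegaPow d (a : ℕ) ^ k • spectralProj d U a := by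
  induction k with
  | zero => simp
  | succ k ih =>
    rw [pow_succ, mul_assoc, mul_spectralProj hU, mul_smul_comm, ih, smul_smul, pow_succ']

theorem sum_spectralProj (hd : d ≠ 0) : ∑ a, spectralProj d U a = 1 := by
  simp only [spectralProj]
  rw [← smul_sum, sum_comm]
  have : ∀ k ∈ range d, ∑ a : Fin d, ((omegaPow d (a : ℕ))⁻¹ • U) ^ k
      = if k = 0 then (d : ℂ) • 1 else 0 := fun k hk => by
    simp only [smul_pow]
    rw [← sum_smul, sum_fin_inv_pow (mem_range.1 hk)]
    split_ifs with h <;> simp [h]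
  rw [sum_congr rfl this, sum_ite_eq' (range d) 0, if_pos (mem_range.2 (by omega)), smul_smul,
    inv_mul_cancel₀ (Nat.cast_ne_zero.2 hd), one_smul]

theorem pow_eq_sum_spectralProj (hd : d ≠ 0) (hU : U ^ d = 1) (k : ℕ) :
    U ^ k = ∑ a : Fin d, omegaPow d (a : ℕ) ^ k • spectralProj d U a := by
  rw [← sum_congr rfl fun a _ => pow_mul_spectralProj hU a k, ← mul_sum, sum_spectralProj hd,
    mul_one]

/-- With `W = ω⁻ᵃ U` unitary, `W P = P` gives `Wᴴ P = P`; averaging over powers of `Wᴴ` yields `Pᴴ P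
= P`. This contains both Hermiticity and idempotency. -/
theorem conjTranspose_spectralProj_mul_self (hU : U ^ d = 1) (hU' : Uᴴ * U = 1) (a : Fin d) :
    (spectralProj d U a)ᴴ * spectralProj d U a = spectralProj d U a := by
  have hd : (d : ℂ) ≠ 0 := Nat.cast_ne_zero.2 (Fin.pos a).ne'
  set W := (omegaPow d (a : ℕ))⁻¹ • U with hW
  have h0 := omegaPow_ne_zero d (a : ℕ)
  have h1 : Wᴴ * spectralProj d U a = spectralProj d U a := by
    have h2 : Uᴴ * (U * spectralProj d U a) = spectralProj d U a := by
      rw [← mul_assoc, hU', one_mul]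
    rw [mul_spectralProj hU, mul_smul_comm] at h2
    rw [hW, Matrix.conjTranspose_smul, smul_mul_assoc]
    have : star (omegaPow d (a : ℕ))⁻¹ = omegaPow d (a : ℕ) := by
      rw [← starRingEnd_apply, map_inv₀, conj_omegaPow, inv_inv]
    rw [this, h2]
  have h3 : ∀ k, (W ^ k)ᴴ * spectralProj d U a = spectralProj d U a := fun k => by
    induction k with
    | zero => simp
    | succ k ih => rw [pow_succ', Matrix.conjTranspose_mul, mul_assoc, h1, ih]
  have h4 : (spectralProj d U a)ᴴ = ((d : ℂ)⁻¹ • ∑ k ∈ range d, W ^ k)ᴴ := rfl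
  rw [h4, Matrix.conjTranspose_smul, Matrix.conjTranspose_sum, smul_mul_assoc, sum_mul,
    sum_congr rfl fun k _ => h3 k, sum_const, card_range, ← Nat.cast_smul_eq_nsmul ℂ, smul_smul]
  simp [hd]

theorem conjTranspose_spectralProj (hU : U ^ d = 1) (hU' : Uᴴ * U = 1) (a : Fin d) :
    (spectralProj d U a)ᴴ = spectralProj d U a := by
  have h := conjTranspose_spectralProj_mul_self hU hU' a
  have h2 := congrArg Matrix.conjTranspose h
  rw [Matrix.conjTranspose_mul, Matrix.conjTranspose_conjTranspose, h] at h2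
  exact h2.symm

theorem spectralProj_mul_self (hU : U ^ d = 1) (hU' : Uᴴ * U = 1) (a : Fin d) :
    spectralProj d U a * spectralProj d U a = spectralProj d U a := by
  have h := conjTranspose_spectralProj_mul_self hU hU' a
  rwa [conjTranspose_spectralProj hU hU'] at h

theorem spectralProj_mulVec {a : Fin d} {v : n → ℂ}
    (hv : U *ᵥ v = omegaPow d (a : ℕ) • v) : spectralProj d U a *ᵥ v = v := by
  have hd : (d : ℂ) ≠ 0 := Nat.cast_ne_zero.2 (Fin.pos a).ne'
  have h1 : ((omegaPow d (a : ℕ))⁻¹ • U) *ᵥ v = v := by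
    rw [Matrix.smul_mulVec, hv, smul_smul, inv_mul_cancel₀ (omegaPow_ne_zero d _), one_smul]
  have h2 : ∀ k : ℕ, ((omegaPow d (a : ℕ))⁻¹ • U) ^ k *ᵥ v = v := fun k => by
    induction k with
    | zero => simp
    | succ k ih => rw [pow_succ, ← Matrix.mulVec_mulVec, h1, ih]
  rw [spectralProj, Matrix.smul_mulVec, Matrix.sum_mulVec, sum_congr rfl fun k _ => h2 k,
    sum_const, card_range, ← Nat.cast_smul_eq_nsmul ℂ, smul_smul, inv_mul_cancel₀ hd, one_smul]

end

/-! ### Rank-one projections -/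

open scoped ComplexOrder in
/-- A Hermitian idempotent of trace one that fixes a unit vector projects onto that vector. -/
theorem eq_vecMulVec_of_trace_eq_one {n : Type*} [Fintype n] {P : Matrix n n ℂ}
    (hP : Pᴴ = P) (hPP : P * P = P) (htr : P.trace = 1) {v : n → ℂ} (hv : star v ⬝ᵥ v = 1) (hPv : P *ᵥ v = v) :
    P = Matrix.vecMulVec v (star v) := by
  set Q := Matrix.vecMulVec v (star v) with hQ
  have hPQ : P * Q = Q := by rw [hQ, Matrix.mul_vecMulVec, hPv]
  have hQH : Qᴴ = Q := by rw [hQ, Matrix.conjTranspose_vecMulVec, star_star]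
  have hQP : Q * P = Q := by
    have := congrArg Matrix.conjTranspose hPQ
    rwa [Matrix.conjTranspose_mul, hQH, hP] at this
  have hQQ : Q * Q = Q := by
    rw [hQ, Matrix.vecMulVec_mul_vecMulVec, hv, one_smul]
  have htQ : Q.trace = 1 := by
    rw [hQ, Matrix.trace_vecMulVec, dotProduct_comm, hv]
  -- Hence the squared Hilbert–Schmidt norm of `P - Q` is its trace, which is zero.
  have h : (P - Q)ᴴ * (P - Q) = P - Q := by
    rw [Matrix.conjTranspose_sub, hP, hQH, sub_mul, mul_sub, mul_sub, hPP, hPQ, hQP, hQQ]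
    simp
  have h0 : ((P - Q)ᴴ * (P - Q)).trace = 0 := by rw [h, Matrix.trace_sub, htr, htQ, sub_self]
  exact sub_eq_zero.1 (Matrix.trace_conjTranspose_mul_self_eq_zero_iff.1 h0)

/-! ### The Hilbert–Schmidt norm -/

section
variable {n : Type*} [Fintype n]

theorem trace_mul_conjTranspose_re (X : Matrix n n ℂ) :
    (X * Xᴴ).trace.re = ∑ i, ∑ j, ‖X i j‖ ^ 2 := by
  simp only [Matrix.trace, Matrix.diag_apply, Matrix.mul_apply, Matrix.conjTranspose_apply,
    Complex.re_sum]
  refine sum_congr rfl fun i _ => sum_congr rfl fun j _ => ?_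
  rw [← starRingEnd_apply, Complex.mul_conj, Complex.normSq_eq_norm_sq, Complex.ofReal_re]

theorem trace_mul_conjTranspose_re_nonneg (X : Matrix n n ℂ) : 0 ≤ (X * Xᴴ).trace.re := by
  rw [trace_mul_conjTranspose_re]
  positivity

theorem eq_zero_of_trace_mul_conjTranspose_re_le {X : Matrix n n ℂ}
    (h : (X * Xᴴ).trace.re ≤ 0) : X = 0 := by
  rw [trace_mul_conjTranspose_re] at h
  have h1 := le_antisymm h (by positivity)
  ext i j
  have h2 := (sum_eq_zero_iff_of_nonneg fun i _ => by positivity).1 h1 i (mem_univ i)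
  have h3 := (sum_eq_zero_iff_of_nonneg fun i _ => by positivity).1 h2 j (mem_univ j)
  simpa using h3

theorem conj_trace_mul_conjTranspose (X Y : Matrix n n ℂ) :
    (starRingEnd ℂ) (X * Yᴴ).trace = (Y * Xᴴ).trace := by
  rw [starRingEnd_apply, ← Matrix.trace_conjTranspose, Matrix.conjTranspose_mul,
    Matrix.conjTranspose_conjTranspose]

end

/-! ### Repeatable measurements are projective -/

variable {d D : ℕ}

/-- The POVM element of the outcome `a`. -/
def effect (A : Measurement d D) (a : Fin d) : Matrix (Fin D) (Fin D) ℂ :=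
  (A.kraus a)ᴴ * A.kraus a

theorem sum_effect (A : Measurement d D) : ∑ a, effect A a = 1 := A.complete

theorem conjTranspose_effect (A : Measurement d D) (a : Fin d) : (effect A a)ᴴ = effect A a := by
  simp [effect]

theorem postState_eq (A : Measurement d D) (a : Fin d) :
    postState A a = (D : ℂ)⁻¹ • (A.kraus a * (A.kraus a)ᴴ) := by
  simp [postState, maximallyMixed]

theorem jointProb_eq_trace (A B : Measurement d D) (a b : Fin d) :
    jointProb A B a b
      = (D : ℝ)⁻¹ * ((B.kraus b * A.kraus a) * (B.kraus b * A.kraus a)ᴴ).trace.re := by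
  rw [jointProb, postState_eq, mul_smul_comm, smul_mul_assoc, Matrix.trace_smul, smul_eq_mul,
    Matrix.conjTranspose_mul]
  simp only [mul_assoc]
  rw [← Complex.ofReal_natCast, ← Complex.ofReal_inv, Complex.re_ofReal_mul]

theorem jointProb_nonneg (A B : Measurement d D) (a b : Fin d) : 0 ≤ jointProb A B a b := by
  rw [jointProb_eq_trace]
  exact mul_nonneg (by positivity) (trace_mul_conjTranspose_re_nonneg _)

namespace IsRepeatable

variable {A B : Measurement d D}

/-- The outcome `b = a` exhausts the marginal, so every other joint probability, a squared
Hilbert–Schmidt norm up to `1 / D`, vanishes. -/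
theorem kraus_mul_kraus (hA : IsRepeatable A) (hD : 0 < D) {a b : Fin d} (hab : a ≠ b) :
    A.kraus b * A.kraus a = 0 := by
  have h1 := sum_jointProb A A a
  rw [← add_sum_erase _ _ (mem_univ a), hA a, add_eq_left] at h1
  have h2 := (sum_eq_zero_iff_of_nonneg fun b _ => jointProb_nonneg A A a b).1 h1 b
    (mem_erase.2 ⟨hab.symm, mem_univ b⟩)
  rw [jointProb_eq_trace] at h2
  have hD' : (D : ℝ)⁻¹ ≠ 0 := by positivity
  exact eq_zero_of_trace_mul_conjTranspose_re_le ((mul_eq_zero.1 h2).resolve_left hD').le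

theorem effect_mul_kraus (hA : IsRepeatable A) (hD : 0 < D) (a : Fin d) :
    effect A a * A.kraus a = A.kraus a := by
  have h := congrArg (· * A.kraus a) (sum_effect A)
  simp only [sum_mul, one_mul] at h
  rw [sum_eq_single a (fun b _ hb => by
    rw [effect, mul_assoc, hA.kraus_mul_kraus hD hb.symm, mul_zero]) (by simp)] at h
  exact h

/-- With `F = K Kᴴ` and `E = Kᴴ K`: `E F = F`, and `F`, `E` have equal traces and equal traces of
squares. So `‖F - E‖² = 2 Tr[E²] - 2 Tr[E]`, while `Tr[E²] ≤ Tr[E]` because the other effects pair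
nonnegatively with `E`. -/
theorem kraus_mul_conjTranspose (hA : IsRepeatable A) (hD : 0 < D) (a : Fin d) :
    A.kraus a * (A.kraus a)ᴴ = effect A a := by
  set K := A.kraus a with hK
  set F := K * Kᴴ with hF
  set E := effect A a with hE
  have hEK : E * K = K := hA.effect_mul_kraus hD a
  have hEF : E * F = F := by rw [hF, ← mul_assoc, hEK]
  have hEH : Eᴴ = E := conjTranspose_effect A a
  have hFH : Fᴴ = F := by simp [hF]
  have hFE : F * E = F := by
    have := congrArg Matrix.conjTranspose hEF
    rwa [Matrix.conjTranspose_mul, hEH, hFH] at this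
  have htr : F.trace = E.trace := by rw [hF, Matrix.trace_mul_comm]; rfl
  have htr2 : (F * F).trace = (E * E).trace := by
    have : E * E = Kᴴ * (K * Kᴴ * K) := by
      rw [hE, effect, ← hK]; simp only [mul_assoc]
    rw [this, Matrix.trace_mul_comm Kᴴ, hF]
    simp only [mul_assoc]
  have hle : (E * E).trace.re ≤ E.trace.re := by
    have h1 : E.trace = ∑ b, (E * effect A b).trace := by
      rw [← Matrix.trace_sum, ← mul_sum, sum_effect, mul_one]
    rw [h1, ← add_sum_erase _ _ (mem_univ a), Complex.add_re, Complex.re_sum]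
    refine le_add_of_nonneg_right (sum_nonneg fun b _ => ?_)
    have h2 : (E * effect A b).trace
        = ((A.kraus b * Kᴴ) * (A.kraus b * Kᴴ)ᴴ).trace := by
      rw [hE, effect, effect, ← hK, Matrix.conjTranspose_mul, Matrix.conjTranspose_conjTranspose,
        ← mul_assoc, Matrix.trace_mul_comm]
      simp only [mul_assoc]
    rw [h2]
    exact trace_mul_conjTranspose_re_nonneg _
  have hzero : F - E = 0 := by
    apply eq_zero_of_trace_mul_conjTranspose_re_le
    rw [Matrix.conjTranspose_sub, hFH, hEH, sub_mul, mul_sub, mul_sub, hFE, hEF]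
    simp only [Matrix.trace_sub, Complex.sub_re, htr, htr2]
    linarith
  exact sub_eq_zero.1 hzero

theorem effect_mul_self (hA : IsRepeatable A) (hD : 0 < D) (a : Fin d) :
    effect A a * effect A a = effect A a := by
  conv_lhs => rw [← hA.kraus_mul_conjTranspose hD a, hA.kraus_mul_conjTranspose hD a]
  nth_rw 2 [← hA.kraus_mul_conjTranspose hD a]
  rw [← mul_assoc, hA.effect_mul_kraus hD, hA.kraus_mul_conjTranspose hD]

theorem effect_mul_effect (hA : IsRepeatable A) (hD : 0 < D) (a b : Fin d) :
    effect A a * effect A b = if a = b then effect A a else 0 := by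
  split_ifs with hab
  · rw [← hab, hA.effect_mul_self hD]
  · rw [← hA.kraus_mul_conjTranspose hD b, effect, mul_assoc, ← mul_assoc (A.kraus a),
      hA.kraus_mul_kraus hD (Ne.symm hab), zero_mul, mul_zero]

theorem jointProb_eq (hA : IsRepeatable A) (hD : 0 < D) (B : Measurement d D) (a b : Fin d) :
    (jointProb A B a b : ℂ) = (D : ℂ)⁻¹ * (effect A a * effect B b).trace := by
  have hreal : (starRingEnd ℂ) (effect A a * effect B b).trace
      = (effect A a * effect B b).trace := by
    rw [starRingEnd_apply, ← Matrix.trace_conjTranspose, Matrix.conjTranspose_mul,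
      conjTranspose_effect, conjTranspose_effect, Matrix.trace_mul_comm]
  have h : ((B.kraus b * A.kraus a) * (B.kraus b * A.kraus a)ᴴ).trace
      = (effect A a * effect B b).trace := by
    rw [← hA.kraus_mul_conjTranspose hD, effect, Matrix.conjTranspose_mul,
      Matrix.trace_mul_comm (A.kraus a * (A.kraus a)ᴴ), mul_assoc ((B.kraus b)ᴴ),
      Matrix.trace_mul_comm ((B.kraus b)ᴴ)]
    simp only [mul_assoc]
  rw [jointProb_eq_trace, h, Complex.ofReal_mul, Complex.conj_eq_iff_re.1 hreal]
  push_cast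
  rfl

end IsRepeatable

/-! ### Observables -/

/-- The observable `∑ ω ^ a E_a` of a measurement with POVM elements `E_a`. -/
def observable (A : Measurement d D) : Matrix (Fin D) (Fin D) ℂ :=
  ∑ a : Fin d, omegaPow d (a : ℕ) • effect A a

namespace IsRepeatable

variable {A B : Measurement d D}

theorem observable_pow (hA : IsRepeatable A) (hD : 0 < D) (k : ℕ) :
    observable A ^ k = ∑ a : Fin d, omegaPow d (a : ℕ) ^ k • effect A a := by
  induction k with
  | zero => simp [sum_effect]
  | succ k ih =>
    rw [pow_succ, ih, observable, sum_mul]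
    refine sum_congr rfl fun a _ => ?_
    rw [mul_sum, sum_eq_single a (fun b _ hb => by
      rw [smul_mul_smul_comm, hA.effect_mul_effect hD, if_neg hb.symm, smul_zero]) (by simp),
      smul_mul_smul_comm, hA.effect_mul_self hD, pow_succ]

theorem observable_pow_order (hA : IsRepeatable A) (hD : 0 < D) (hd : d ≠ 0) :
    observable A ^ d = 1 := by
  rw [hA.observable_pow hD]
  simp only [omegaPow_natCast_pow_self hd, one_smul, sum_effect]

theorem conjTranspose_observable_mul_self (hA : IsRepeatable A) (hD : 0 < D) :
    (observable A)ᴴ * observable A = 1 := by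
  rw [observable, Matrix.conjTranspose_sum, sum_mul, ← sum_effect A]
  refine sum_congr rfl fun a _ => ?_
  rw [Matrix.conjTranspose_smul, conjTranspose_effect, mul_sum,
    sum_eq_single a (fun b _ hb => by
      rw [smul_mul_smul_comm, hA.effect_mul_effect hD, if_neg hb.symm, smul_zero]) (by simp),
    smul_mul_smul_comm, hA.effect_mul_self hD, ← starRingEnd_apply, conj_omegaPow,
    inv_mul_cancel₀ (omegaPow_ne_zero _ _), one_smul]

theorem conjTranspose_observable_pow_mul_self (hA : IsRepeatable A) (hD : 0 < D) (k : ℕ) :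
    (observable A ^ k)ᴴ * observable A ^ k = 1 := by
  induction k with
  | zero => simp
  | succ k ih =>
    rw [pow_succ', Matrix.conjTranspose_mul, mul_assoc, ← mul_assoc (observable A)ᴴ,
      hA.conjTranspose_observable_mul_self hD, one_mul, ih]

theorem observable_pow_mul_conjTranspose (hA : IsRepeatable A) (hD : 0 < D) (k : ℕ) :
    observable A ^ k * (observable A ^ k)ᴴ = 1 :=
  mul_eq_one_comm.1 (hA.conjTranspose_observable_pow_mul_self hD k)

theorem observable_pow_sub (hA : IsRepeatable A) (hD : 0 < D) (hd : d ≠ 0) {k : ℕ}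
    (hk : k ≤ d) : observable A ^ (d - k) = (observable A ^ k)ᴴ := by
  have h : observable A ^ k * observable A ^ (d - k) = 1 := by
    rw [← pow_add, Nat.add_sub_cancel' hk, hA.observable_pow_order hD hd]
  calc observable A ^ (d - k)
      = (observable A ^ k)ᴴ * observable A ^ k * observable A ^ (d - k) := by
        rw [hA.conjTranspose_observable_pow_mul_self hD, one_mul]
    _ = _ := by rw [mul_assoc, h, mul_one]

/-- Fourier inversion: the observable determines the POVM, so probabilities can be read off from
traces of powers. -/
theorem spectralProj_observable (hA : IsRepeatable A) (hD : 0 < D) (a : Fin d) :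
    spectralProj d (observable A) a = effect A a := by
  have hd : (d : ℂ) ≠ 0 := Nat.cast_ne_zero.2 (Fin.pos a).ne'
  simp only [spectralProj, smul_pow, hA.observable_pow hD, smul_sum, smul_smul]
  rw [sum_comm]
  simp only [← mul_pow, ← sum_smul]
  simp only [← mul_sum, sum_range_inv_mul_pow]
  rw [sum_eq_single a (fun b _ hb => by simp [hb.symm]) (by simp)]
  simp [hd]

theorem correlator_eq (hA : IsRepeatable A) (hB : IsRepeatable B) (hD : 0 < D) (k l : ℕ) :
    correlator A B k l = (D : ℂ)⁻¹ * (observable A ^ k * observable B ^ l).trace := by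
  rw [hA.observable_pow hD, hB.observable_pow hD, sum_mul, Matrix.trace_sum, mul_sum, correlator]
  refine sum_congr rfl fun a _ => ?_
  rw [mul_sum, Matrix.trace_sum, mul_sum]
  refine sum_congr rfl fun b _ => ?_
  rw [hA.jointProb_eq hD, omegaPow_add, mul_comm (a : ℝ), mul_comm (b : ℝ),
    omegaPow_natCast_mul, omegaPow_natCast_mul, smul_mul_smul_comm, Matrix.trace_smul,
    smul_eq_mul]
  ring

end IsRepeatable

/-! ### The temporal expression as a sum of squares -/

section Strategy

open scoped ComplexConjugate

variable {A : Strategy d D}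

/-- `a_k A_1^k + a_k^* A_2^k`, the value of `A_3^k` in an optimal strategy. -/
def thirdCombination (A : Strategy d D) (k : ℕ) : Matrix (Fin D) (Fin D) ℂ :=
  coeff d k • observable (A 0) ^ k + conj (coeff d k) • observable (A 1) ^ k

/-- `a_k^* ω^k A_1^k + a_k A_2^k`, the value of `A_4^k` in an optimal strategy. -/
def fourthCombination (A : Strategy d D) (k : ℕ) : Matrix (Fin D) (Fin D) ℂ :=
  (conj (coeff d k) * omegaPow d k) • observable (A 0) ^ k
    + coeff d k • observable (A 1) ^ k

/-- `U^(d-k) = (U^k)ᴴ`, and cyclicity of the trace identifies the two measurement orders, whence the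
factor `2`. -/
theorem temporalValue_eq (hA : ∀ i, IsRepeatable (A i)) (hD : 0 < D) (hd : d ≠ 0) :
    temporalValue A = 2 * (D : ℂ)⁻¹ * ∑ k ∈ Icc 1 (d - 1),
      ((thirdCombination A k * (observable (A 2) ^ k)ᴴ).trace
        + (fourthCombination A k * (observable (A 3) ^ k)ᴴ).trace) := by
  rw [temporalValue, mul_sum]
  refine sum_congr rfl fun k hk => ?_
  have hk' : k ≤ d := by
    have := mem_Icc.1 hk
    omega
  simp only [(hA _).correlator_eq (hA _) hD, (hA _).observable_pow_sub hD hd hk']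
  simp only [Matrix.trace_mul_comm ((observable (A 2) ^ k)ᴴ),
    Matrix.trace_mul_comm ((observable (A 3) ^ k)ᴴ), thirdCombination, fourthCombination,
    add_mul, smul_mul_assoc, Matrix.trace_add, Matrix.trace_smul, smul_eq_mul]
  ring

theorem coeff_mul_conj (k : ℕ) : coeff d k * conj (coeff d k) = 1 / 2 := by
  rw [conj_coeff, coeff_eq]
  have h0 : quarterRoot d ^ k ≠ 0 := pow_ne_zero _ (quarterRoot_ne_zero d)
  field_simp
  linear_combination -Complex.I_sq

theorem coeff_sq_add (k : ℕ) :
    coeff d k * coeff d k + conj (coeff d k) * (conj (coeff d k) * omegaPow d k) = 0 := by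
  rw [conj_coeff, coeff_eq, omegaPow_natCast, omegaPow_one]
  have h0 : quarterRoot d ^ k ≠ 0 := pow_ne_zero _ (quarterRoot_ne_zero d)
  rw [← pow_mul, mul_comm 4 k, pow_mul]
  field_simp
  linear_combination 2 * (quarterRoot d ^ k) ^ 2 * Complex.I_sq

theorem conj_coeff_sq_add (k : ℕ) :
    conj (coeff d k) * conj (coeff d k)
      + coeff d k * (coeff d k * conj (omegaPow d k)) = 0 := by
  have h := congrArg conj (coeff_sq_add (d := d) k)
  simpa using h

/-- The choice of the `a_k` makes the cross terms `Uᴴ V` and `Vᴴ U` cancel, and `|a_k|² = 1/2`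
normalizes the rest. -/
theorem sum_combinations (hA : ∀ i, IsRepeatable (A i)) (hD : 0 < D) (k : ℕ) :
    (thirdCombination A k)ᴴ * thirdCombination A k
      + (fourthCombination A k)ᴴ * fourthCombination A k = (2 : ℂ) • 1 := by
  have h0 := (hA 0).conjTranspose_observable_pow_mul_self hD k
  have h1 := (hA 1).conjTranspose_observable_pow_mul_self hD k
  set U := observable (A 0) ^ k
  set V := observable (A 1) ^ k
  have hw : conj (omegaPow d k) * omegaPow d k = 1 := by
    rw [conj_omegaPow, inv_mul_cancel₀ (omegaPow_ne_zero _ _)]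
  have c1 := coeff_mul_conj (d := d) k
  have c2 := coeff_sq_add (d := d) k
  have c3 := conj_coeff_sq_add (d := d) k
  have e : (thirdCombination A k)ᴴ * thirdCombination A k
      + (fourthCombination A k)ᴴ * fourthCombination A k
      = (coeff d k * conj (coeff d k)) • (Uᴴ * U)
        + (coeff d k * conj (coeff d k) * (conj (omegaPow d k) * omegaPow d k)) • (Uᴴ * U)
        + (2 * (coeff d k * conj (coeff d k))) • (Vᴴ * V)
        + (conj (coeff d k) * conj (coeff d k)
            + coeff d k * (coeff d k * conj (omegaPow d k))) • (Uᴴ * V)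
        + (coeff d k * coeff d k
            + conj (coeff d k) * (conj (coeff d k) * omegaPow d k)) • (Vᴴ * U) := by
    simp only [thirdCombination, fourthCombination, Matrix.conjTranspose_add,
      Matrix.conjTranspose_smul, add_mul, mul_add, smul_mul_smul_comm, ← starRingEnd_apply,
      map_mul, Complex.conj_conj]
    module
  rw [e, hw, c1, c2, c3, h0, h1]
  module

theorem sum_defect (hA : ∀ i, IsRepeatable (A i)) (hD : 0 < D) (k : ℕ) :
    ((observable (A 2) ^ k - thirdCombination A k)
        * (observable (A 2) ^ k - thirdCombination A k)ᴴ).trace.re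
      + ((observable (A 3) ^ k - fourthCombination A k)
        * (observable (A 3) ^ k - fourthCombination A k)ᴴ).trace.re
      = 4 * D - 2 * ((thirdCombination A k * (observable (A 2) ^ k)ᴴ).trace
        + (fourthCombination A k * (observable (A 3) ^ k)ᴴ).trace).re := by
  have expand : ∀ X Y : Matrix (Fin D) (Fin D) ℂ, X * Xᴴ = 1 →
      ((X - Y) * (X - Y)ᴴ).trace.re = D - 2 * (Y * Xᴴ).trace.re + (Yᴴ * Y).trace.re := by
    intro X Y hX
    have h := congrArg Complex.re (conj_trace_mul_conjTranspose X Y)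
    rw [Complex.conj_re] at h
    rw [Matrix.conjTranspose_sub, sub_mul, mul_sub, mul_sub, hX, Matrix.trace_mul_comm Yᴴ]
    simp only [Matrix.trace_sub, Complex.sub_re, h, Matrix.trace_one, Fintype.card_fin,
      Complex.natCast_re]
    ring
  have hs := congrArg (fun M => M.trace.re) (sum_combinations hA hD k)
  simp only [Matrix.trace_add, Complex.add_re, Matrix.trace_smul, Matrix.trace_one,
    Fintype.card_fin, smul_eq_mul] at hs
  rw [show ((2 : ℂ) * D).re = 2 * D by simp] at hs
  rw [expand _ _ ((hA 2).observable_pow_mul_conjTranspose hD k),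
    expand _ _ ((hA 3).observable_pow_mul_conjTranspose hD k), Complex.add_re]
  linarith

theorem IsOptimal.combinations (hA : IsOptimal A) (hd : d ≠ 0) {k : ℕ} (hk0 : 0 < k)
    (hk : k < d) : observable (A 2) ^ k = thirdCombination A k
      ∧ observable (A 3) ^ k = fourthCombination A k := by
  have hD := hA.dim_pos
  have hr := hA.repeatable
  have hD' : (D : ℝ) ≠ 0 := by positivity
  have hval := congrArg Complex.re ((temporalValue_eq hr hD hd).symm.trans hA.value)
  have h2 : (2 * (D : ℂ)⁻¹) = ((2 * (D : ℝ)⁻¹ : ℝ) : ℂ) := by push_cast; rfl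
  have h4 : (4 * ((d : ℂ) - 1)) = ((4 * ((d : ℝ) - 1) : ℝ) : ℂ) := by push_cast; rfl
  rw [h2, h4, Complex.re_ofReal_mul, Complex.ofReal_re, Complex.re_sum] at hval
  -- The maximal value makes the total of all squared defects zero, so each one vanishes.
  have hsum : ∑ k ∈ Icc 1 (d - 1),
      (((observable (A 2) ^ k - thirdCombination A k)
        * (observable (A 2) ^ k - thirdCombination A k)ᴴ).trace.re
      + ((observable (A 3) ^ k - fourthCombination A k)
        * (observable (A 3) ^ k - fourthCombination A k)ᴴ).trace.re) = 0 := by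
    rw [sum_congr rfl fun k _ => sum_defect hr hD k, sum_sub_distrib, sum_const, ← mul_sum,
      Nat.card_Icc, nsmul_eq_mul, Nat.add_sub_cancel, Nat.cast_sub (by omega)]
    field_simp at hval
    push_cast
    linarith
  have hnn := fun k (_ : k ∈ Icc 1 (d - 1)) => add_nonneg
    (trace_mul_conjTranspose_re_nonneg (observable (A 2) ^ k - thirdCombination A k))
    (trace_mul_conjTranspose_re_nonneg (observable (A 3) ^ k - fourthCombination A k))
  have hz := (sum_eq_zero_iff_of_nonneg hnn).1 hsum k (mem_Icc.2 ⟨hk0, by omega⟩)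
  have hp := trace_mul_conjTranspose_re_nonneg (observable (A 2) ^ k - thirdCombination A k)
  have hq := trace_mul_conjTranspose_re_nonneg (observable (A 3) ^ k - fourthCombination A k)
  exact ⟨sub_eq_zero.1 (eq_zero_of_trace_mul_conjTranspose_re_le (by linarith)),
    sub_eq_zero.1 (eq_zero_of_trace_mul_conjTranspose_re_le (by linarith))⟩

theorem isOptimal_of_combinations (hA : ∀ i, IsRepeatable (A i)) (hD : 0 < D) (hd : d ≠ 0)
    (h2 : ∀ k, 0 < k → k < d → observable (A 2) ^ k = thirdCombination A k)
    (h3 : ∀ k, 0 < k → k < d → observable (A 3) ^ k = fourthCombination A k) :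
    IsOptimal A := by
  refine ⟨hD, hA, ?_⟩
  have hD' : (D : ℂ) ≠ 0 := Nat.cast_ne_zero.2 hD.ne'
  have h : ∀ k ∈ Icc 1 (d - 1), (thirdCombination A k * (observable (A 2) ^ k)ᴴ).trace
        + (fourthCombination A k * (observable (A 3) ^ k)ᴴ).trace = 2 * D := fun k hk => by
    have hk' := mem_Icc.1 hk
    rw [← h2 k (by omega) (by omega), ← h3 k (by omega) (by omega),
      (hA 2).observable_pow_mul_conjTranspose hD, (hA 3).observable_pow_mul_conjTranspose hD]
    simp
    ring
  rw [temporalValue_eq hA hD hd, sum_congr rfl h, sum_const, Nat.card_Icc, nsmul_eq_mul,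
    Nat.add_sub_cancel, Nat.cast_sub (by omega)]
  field_simp
  push_cast
  ring

end Strategy

/-! ### The four observables of a shift resolution -/

/-- The phases of the four observables. -/
def phase (d : ℕ) (i : Fin 4) : ℂ := quarterRoot d ^ (![0, 2, 1, 3] i : ℕ)

/-- The coefficients `c` of the four observables `phase • (1 - c • R) * A`. -/
def weight : Fin 4 → ℂ := ![0, 2, 1 + Complex.I, 1 - Complex.I]

/-- The `k`-th power of the `i`-th observable built from a shift resolution. -/
def modelPow {n : Type*} [Fintype n] [DecidableEq n] (d : ℕ) (A A' R : Matrix n n ℂ) (i : Fin 4)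
    (k : ℕ) : Matrix n n ℂ :=
  phase d i ^ k • ((1 - weight i • shiftSum A A' R k) * A ^ k)

theorem norm_phase (d : ℕ) (i : Fin 4) : ‖phase d i‖ = 1 := by
  rw [phase, norm_pow, norm_quarterRoot, one_pow]

/-- This is the condition that the `d`-th power is `1`, as `shiftSum` equals `1` there: `i^m` with
`m = 0, 2, 1, 3` is inverse to `1 - weight`. -/
theorem phase_pow_mul {d : ℕ} (hd : d ≠ 0) (i : Fin 4) : phase d i ^ d * (1 - weight i) = 1 := by
  rw [phase, ← pow_mul, mul_comm _ d, pow_mul, quarterRoot_pow_self hd]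
  fin_cases i <;> simp [weight, Complex.I_pow_three]
  norm_num

/-- Equivalent to `|1 - c| = 1`; it makes `1 - c R` unitary for a Hermitian idempotent `R`. -/
theorem weight_add_conj (i : Fin 4) :
    weight i + (starRingEnd ℂ) (weight i) = (starRingEnd ℂ) (weight i) * weight i := by
  fin_cases i <;> simp [weight, Complex.ext_iff]; norm_num

section
variable {n : Type*} [Fintype n] [DecidableEq n] {d : ℕ}

theorem modelPow_two (A A' R : Matrix n n ℂ) (k : ℕ) :
    modelPow d A A' R 2 k = coeff d k • modelPow d A A' R 0 k
      + (starRingEnd ℂ) (coeff d k) • modelPow d A A' R 1 k := by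
  have h0 : quarterRoot d ^ k ≠ 0 := pow_ne_zero _ (quarterRoot_ne_zero d)
  have e : (starRingEnd ℂ) (coeff d k) * (quarterRoot d ^ 2) ^ k
      = (1 + Complex.I) / 2 * quarterRoot d ^ k := by
    rw [conj_coeff, ← pow_mul, mul_comm 2 k, pow_mul]
    field_simp
  simp only [modelPow, phase, weight, sub_mul, one_mul, smul_mul_assoc]
  simp only [Fin.isValue, Matrix.cons_val, pow_zero, pow_one, one_pow, one_smul, zero_smul,
    sub_zero, smul_smul, e]
  rw [coeff_eq]
  module

theorem modelPow_three (A A' R : Matrix n n ℂ) (k : ℕ) :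
    modelPow d A A' R 3 k
      = ((starRingEnd ℂ) (coeff d k) * omegaPow d k) • modelPow d A A' R 0 k
        + coeff d k • modelPow d A A' R 1 k := by
  have h0 : quarterRoot d ^ k ≠ 0 := pow_ne_zero _ (quarterRoot_ne_zero d)
  have e : (starRingEnd ℂ) (coeff d k) * omegaPow d k
      = (1 + Complex.I) / 2 * (quarterRoot d ^ 3) ^ k := by
    rw [conj_coeff, omegaPow_natCast, omegaPow_one, ← pow_mul, ← pow_mul, mul_comm 4 k, pow_mul,
      mul_comm 3 k, pow_mul]
    field_simp
  have e' : coeff d k * (quarterRoot d ^ 2) ^ k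
      = (1 - Complex.I) / 2 * (quarterRoot d ^ 3) ^ k := by
    rw [coeff_eq]
    ring
  simp only [modelPow, phase, weight, sub_mul, one_mul, smul_mul_assoc, e]
  simp only [Fin.isValue, Matrix.cons_val, pow_zero, one_pow, one_smul, zero_smul,
    sub_zero, smul_smul, e']
  module

end

/-- In an optimal strategy the four observables come from a shift resolution. -/
theorem IsOptimal.exists_shiftResolution {d D : ℕ} {A : Strategy d D} (hA : IsOptimal A)
    (hd : d ≠ 0) : ∃ X X' R : Matrix (Fin D) (Fin D) ℂ, IsShiftResolution d X X' R ∧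
      ∀ i, ∀ k < d, observable (A i) ^ k = modelPow d X X' R i k := by
  have hD := hA.dim_pos
  have hr := hA.repeatable
  have hu := (hr 0).conjTranspose_observable_mul_self hD
  -- The first three observables already produce `R`; the fourth is then a combination of the first
  -- two.
  obtain ⟨R, hR, hB⟩ := isShiftResolution_of_pow_eq hd (mul_eq_one_comm.1 hu) hu
    ((hr 0).observable_pow_order hD hd) ((hr 1).observable_pow_order hD hd)
    ((hr 2).observable_pow_order hD hd) fun k hk0 hk => (hA.combinations hd hk0 hk).1
  refine ⟨_, _, R, hR, ?_⟩
  have h0 : ∀ k < d, observable (A 0) ^ k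
      = modelPow d (observable (A 0)) (observable (A 0))ᴴ R 0 k :=
    fun k _ => by simp [modelPow, phase, weight]
  have h1 : ∀ k < d, observable (A 1) ^ k
      = modelPow d (observable (A 0)) (observable (A 0))ᴴ R 1 k :=
    fun k hk => by simpa [modelPow, phase, weight] using hB k hk.le
  have h2 : ∀ k < d, observable (A 2) ^ k
      = modelPow d (observable (A 0)) (observable (A 0))ᴴ R 2 k :=
    fun k hk => by
      rcases Nat.eq_zero_or_pos k with rfl | hk0
      · simp [modelPow, shiftSum]
      · rw [modelPow_two, ← h0 k hk, ← h1 k hk]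
        exact (hA.combinations hd hk0 hk).1
  have h3 : ∀ k < d, observable (A 3) ^ k
      = modelPow d (observable (A 0)) (observable (A 0))ᴴ R 3 k :=
    fun k hk => by
      rcases Nat.eq_zero_or_pos k with rfl | hk0
      · simp [modelPow, shiftSum]
      · rw [modelPow_three, ← h0 k hk, ← h1 k hk]
        exact (hA.combinations hd hk0 hk).2
  intro i
  fin_cases i
  exacts [h0, h1, h2, h3]

/-! ### The joint distribution of an optimal strategy -/

/-- The joint probability of the outcomes `a`, `b` of the `i`-th and the `j`-th measurement in
any optimal strategy. -/
def profile (d : ℕ) (i j : Fin 4) (a b : Fin d) : ℂ :=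
  ((d : ℂ) ^ 2)⁻¹ * ∑ k ∈ range d, ∑ l ∈ range d,
    ((omegaPow d (a : ℕ))⁻¹ ^ k * (omegaPow d (b : ℕ))⁻¹ ^ l) * (phase d i ^ k * phase d j ^ l *
      ((d - weight i * k - weight j * l) * if d ∣ k + l then (d : ℂ)⁻¹ else 0))

/-- Expanding both projections in powers reduces this to `trace_correlation`. The dimension enters
only as an overall factor, which the maximally mixed state cancels. -/
theorem IsShiftResolution.trace_spectralProj_mul {n : Type*} [Fintype n] [DecidableEq n] {d : ℕ}
    {A A' R U V : Matrix n n ℂ} (h : IsShiftResolution d A A' R) {i j : Fin 4}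
    (hU : ∀ k < d, U ^ k = modelPow d A A' R i k) (hV : ∀ k < d, V ^ k = modelPow d A A' R j k)
    (a b : Fin d) : (spectralProj d U a * spectralProj d V b).trace
      = Fintype.card n * profile d i j a b := by
  rw [spectralProj, spectralProj, smul_mul_smul_comm, Matrix.trace_smul, sum_mul,
    Matrix.trace_sum, profile, smul_eq_mul, mul_left_comm (Fintype.card n : ℂ), ← _root_.mul_inv,
    ← pow_two (d : ℂ), mul_sum (range d) _ (Fintype.card n : ℂ)]
  congr 1
  refine sum_congr rfl fun k hk => ?_
  rw [mul_sum, Matrix.trace_sum, mul_sum]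
  refine sum_congr rfl fun l hl => ?_
  rw [smul_pow, smul_pow, hU k (mem_range.1 hk), hV l (mem_range.1 hl), modelPow, modelPow,
    smul_mul_smul_comm, Matrix.trace_smul, smul_mul_smul_comm, Matrix.trace_smul,
    h.trace_correlation _ _ (mem_range.1 hk) (mem_range.1 hl)]
  simp only [smul_eq_mul]
  split_ifs <;> ring

theorem IsOptimal.jointProb_eq_profile {d D : ℕ} {A : Strategy d D} (hA : IsOptimal A)
    (hd : d ≠ 0) (i j : Fin 4) (a b : Fin d) :
    (jointProb (A i) (A j) a b : ℂ) = profile d i j a b := by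
  have hD := hA.dim_pos
  have hD' : (D : ℂ) ≠ 0 := Nat.cast_ne_zero.2 hD.ne'
  obtain ⟨X, X', R, hR, hO⟩ := hA.exists_shiftResolution hd
  rw [(hA.repeatable i).jointProb_eq hD, ← (hA.repeatable i).spectralProj_observable hD,
    ← (hA.repeatable j).spectralProj_observable hD, hR.trace_spectralProj_mul (hO i) (hO j),
    Fintype.card_fin, ← mul_assoc, inv_mul_cancel₀ hD', one_mul]

theorem profile_comm {d : ℕ} (i j : Fin 4) (a b : Fin d) :
    profile d i j a b = profile d j i b a := by
  rw [profile, profile, sum_comm]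
  congr 1
  refine sum_congr rfl fun k _ => sum_congr rfl fun l _ => ?_
  rw [add_comm l k]
  ring

/-- The joint distribution as a function of `ω ^ (b - a)`. -/
def shiftProfile (d : ℕ) (i j : Fin 4) (z : ℂ) : ℂ :=
  ((d : ℂ) ^ 2)⁻¹ * ∑ k ∈ range d,
    z ^ k * (phase d i ^ k * phase d j ^ (d - k) * (1 - (weight i * k + weight j * (d - k)) / d))

theorem profile_eq_shiftProfile {d : ℕ} (i j : Fin 4) (a b : Fin d) :
    profile d i j a b = shiftProfile d i j (omegaPow d ((b : ℕ) - (a : ℕ))) := by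
  have hd : d ≠ 0 := (Fin.pos a).ne'
  have hd' : (d : ℂ) ≠ 0 := Nat.cast_ne_zero.2 hd
  rw [profile, shiftProfile]
  congr 1
  refine sum_congr rfl fun k hk => ?_
  have hk' := mem_range.1 hk
  rcases Nat.eq_zero_or_pos k with rfl | hk0
  -- For `k = 0` only `l = 0` survives, whereas `shiftProfile` uses the exponent `d - k = d`;
  -- `phase_pow_mul` reconciles the two.
  · rw [sum_eq_single 0]
    · have := phase_pow_mul hd j
      simp [hd', this]
    · intro l hl hl0
      have := mem_range.1 hl
      rw [if_neg]
      · simp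
      · intro hdvd
        have := Nat.le_of_dvd (by omega) hdvd
        omega
    · simp [hd]
  · rw [sum_eq_single (d - k)]
    · rw [Nat.add_sub_cancel' hk'.le, if_pos dvd_rfl, Nat.cast_sub hk'.le, sub_eq_add_neg (b : ℝ),
        omegaPow_add, add_comm, omegaPow_neg, mul_pow]
      have hb : (omegaPow d (b : ℕ))⁻¹ ^ (d - k) = omegaPow d (b : ℕ) ^ k := by
        rw [inv_pow]
        apply inv_eq_of_mul_eq_one_right
        rw [← pow_add, Nat.sub_add_cancel hk'.le, omegaPow_natCast_pow_self hd]
      rw [hb]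
      field_simp
      ring
    · intro l hl hl0
      have := mem_range.1 hl
      rw [if_neg]
      · simp
      · intro hdvd
        obtain ⟨q, hq⟩ := hdvd
        have hq1 : q < 2 := by
          by_contra hcon
          have : d * 2 ≤ d * q := Nat.mul_le_mul_left d (by omega)
          omega
        interval_cases q <;> omega
    · intro hcon
      exact absurd (mem_range.2 (by omega)) hcon

theorem profile_self {d : ℕ} (i : Fin 4) (a b : Fin d) :
    profile d i i a b = if a = b then (d : ℂ)⁻¹ else 0 := by
  have hd : d ≠ 0 := (Fin.pos a).ne'
  have hd' : (d : ℂ) ≠ 0 := Nat.cast_ne_zero.2 hd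
  rw [profile_eq_shiftProfile, shiftProfile, sub_eq_add_neg, omegaPow_add, omegaPow_neg]
  -- For equal indices every Fourier coefficient is `1`, so character orthogonality remains.
  have h : ∀ k ∈ range d, phase d i ^ k * phase d i ^ (d - k)
      * (1 - (weight i * k + weight i * (d - k)) / d) = 1 := fun k hk => by
    rw [← pow_add, Nat.add_sub_cancel' (mem_range.1 hk).le]
    have e : (weight i * k + weight i * (d - k)) / (d : ℂ) = weight i := by
      field_simp
      ring
    rw [e, phase_pow_mul hd]
  rw [sum_congr rfl fun k hk => by rw [h k hk, mul_one], mul_comm (omegaPow d _),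
    sum_range_inv_mul_pow]
  split_ifs
  · field_simp
  · simp

/-! ### Closed form of the distribution -/

theorem sum_pow_mul_one_sub {d : ℕ} (hd : d ≠ 0) {z : ℂ} (hz : z ^ d = -1) (hz1 : ‖z‖ = 1) :
    ∑ k ∈ range d, z ^ k * (1 - 2 * k / d) = 4 / d * (1 / (‖1 - z‖ : ℂ) ^ 2) := by
  have hd' : (d : ℂ) ≠ 0 := Nat.cast_ne_zero.2 hd
  have hne : 1 - z ≠ 0 := by
    intro h
    rw [← sub_eq_zero.1 h, one_pow] at hz
    norm_num at hz
  have hz0 : z ≠ 0 := by rintro rfl; simp at hz1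
  have h1 : ∀ m : ℕ, (1 - z) * ∑ k ∈ range m, z ^ k = 1 - z ^ m := fun m => by
    rw [mul_neg_geom_sum]
  have h2 : ∀ m : ℕ, (1 - z) * ((1 - z) * ∑ k ∈ range m, (k : ℂ) * z ^ k)
      = z - z ^ m - (1 - z) * ((m : ℂ) - 1) * z ^ m := fun m => by
    induction m with
    | zero => simp
    | succ m ih =>
      rw [sum_range_succ, mul_add, mul_add, ih]
      push_cast
      ring
  -- On the unit circle `|1 - z|² = -(1 - z)² / z`. Both sides of the goal, multiplied by `(1 -
  -- z)²`, equal `-4 z / d`.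
  have hnorm : ((‖1 - z‖ : ℂ)) ^ 2 * z = -(1 - z) ^ 2 := by
    rw [← Complex.mul_conj', map_sub, map_one, ← Complex.inv_eq_conj hz1]
    field_simp
    ring
  have hN : ((‖1 - z‖ : ℂ)) ^ 2 ≠ 0 := by
    simpa using hne
  have hsum : ∑ k ∈ range d, z ^ k * (1 - 2 * k / d)
      = ∑ k ∈ range d, z ^ k - 2 / d * ∑ k ∈ range d, (k : ℂ) * z ^ k := by
    rw [mul_sum, ← sum_sub_distrib]
    refine sum_congr rfl fun k _ => ?_
    ring
  have h1d := h1 d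
  have h2d := h2 d
  rw [hz] at h1d h2d
  rw [hsum]
  apply mul_left_cancel₀ (pow_ne_zero 2 hne)
  calc (1 - z) ^ 2 * (∑ k ∈ range d, z ^ k - 2 / d * ∑ k ∈ range d, (k : ℂ) * z ^ k)
      = (1 - z) * ((1 - z) * ∑ k ∈ range d, z ^ k)
        - 2 / d * ((1 - z) * ((1 - z) * ∑ k ∈ range d, (k : ℂ) * z ^ k)) := by ring
    _ = (1 - z) ^ 2 * (4 / d * (1 / (‖1 - z‖ : ℂ) ^ 2)) := by
      rw [h1d, h2d]
      generalize ((‖1 - z‖ : ℂ)) ^ 2 = N at hnorm hN ⊢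
      field_simp
      linear_combination -4 * hnorm

theorem shiftProfile_zero_one {d : ℕ} (hd : d ≠ 0) (z : ℂ) : shiftProfile d 0 1 z
    = ((d : ℂ) ^ 2)⁻¹ * ∑ k ∈ range d, (z * (quarterRoot d ^ 2)⁻¹) ^ k * (1 - 2 * k / d) := by
  have hd' : (d : ℂ) ≠ 0 := Nat.cast_ne_zero.2 hd
  rw [shiftProfile]
  congr 1
  refine sum_congr rfl fun k hk => ?_
  have h : (quarterRoot d ^ 2) ^ (d - k) = -((quarterRoot d ^ 2)⁻¹ ^ k) := by
    rw [pow_sub₀ _ (pow_ne_zero _ (quarterRoot_ne_zero d)) (mem_range.1 hk).le, ← pow_mul,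
      mul_comm 2 d, pow_mul, quarterRoot_pow_self hd, Complex.I_sq, inv_pow]
    ring
  simp only [phase, weight, Fin.isValue, Matrix.cons_val, pow_zero, one_pow, h, mul_pow]
  field_simp
  ring

/-- The phases contribute `-i μ^(-2k)` and the weights `i (1 - 2k/d)`; the product is the term for
the first two observables. -/
theorem shiftProfile_two_three {d : ℕ} (hd : d ≠ 0) (z : ℂ) :
    shiftProfile d 2 3 z = shiftProfile d 0 1 z := by
  have hd' : (d : ℂ) ≠ 0 := Nat.cast_ne_zero.2 hd
  rw [shiftProfile_zero_one hd, shiftProfile]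
  congr 1
  refine sum_congr rfl fun k hk => ?_
  have h0 := quarterRoot_ne_zero d
  have h : quarterRoot d ^ k * (quarterRoot d ^ 3) ^ (d - k)
      = -Complex.I * (quarterRoot d ^ 2)⁻¹ ^ k := by
    rw [pow_sub₀ _ (pow_ne_zero _ h0) (mem_range.1 hk).le, ← pow_mul,
      mul_comm 3 d, pow_mul, quarterRoot_pow_self hd, Complex.I_pow_three, inv_pow, ← pow_mul,
      ← pow_mul, mul_comm 3, mul_comm 2, pow_mul, pow_mul]
    have := pow_ne_zero k h0
    field_simp
  simp only [phase, weight, Fin.isValue, Matrix.cons_val, pow_one, h, mul_pow]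
  field_simp
  linear_combination z ^ k * (-(d : ℂ) + 2 * k) * Complex.I_sq

theorem profile_zero_one {d : ℕ} (a b : Fin d) :
    profile d 0 1 a b = ((closedFormProb d ((b : ℝ) - (a : ℝ) - 1 / 2) / d : ℝ) : ℂ) := by
  have hd : d ≠ 0 := (Fin.pos a).ne'
  have hd' : (d : ℂ) ≠ 0 := Nat.cast_ne_zero.2 hd
  have e : omegaPow d ((b : ℕ) - (a : ℕ)) * (quarterRoot d ^ 2)⁻¹
      = omegaPow d ((b : ℝ) - (a : ℝ) - 1 / 2) := by
    rw [← omegaPow_half, ← omegaPow_neg, ← omegaPow_add, ← sub_eq_add_neg]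
  have hz : omegaPow d ((b : ℝ) - (a : ℝ) - 1 / 2) ^ d = -1 := by
    rw [← e, mul_pow, inv_pow, ← pow_mul, mul_comm 2 d, pow_mul, quarterRoot_pow_self hd,
      sub_eq_add_neg, omegaPow_add, omegaPow_neg, mul_pow, inv_pow, omegaPow_natCast_pow_self hd,
      omegaPow_natCast_pow_self hd, Complex.I_sq]
    norm_num
  rw [profile_eq_shiftProfile, shiftProfile_zero_one hd, e,
    sum_pow_mul_one_sub hd hz (norm_omegaPow _ _), closedFormProb]
  push_cast
  field_simp

theorem profile_two_three {d : ℕ} (a b : Fin d) : profile d 2 3 a b = profile d 0 1 a b := by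
  rw [profile_eq_shiftProfile, profile_eq_shiftProfile, shiftProfile_two_three (Nat.ne_of_gt (Fin.pos a))]

/-! ### The reference strategy -/

section Reference

variable {d : ℕ}

/-- The unnormalized vector whose rank-one projection is the reference shift resolution. -/
def refVec (d : ℕ) (q : Fin d) : ℂ :=
  (if (q : ℕ) = 0 then (-1 : ℂ) else 1) * omegaPow d ((q : ℝ) / 2)

/-- The rank-one projection of the reference shift resolution. -/
def refProj (d : ℕ) : Matrix (Fin d) (Fin d) ℂ :=
  Matrix.of fun q r => (d : ℂ)⁻¹ * (refVec d q * (starRingEnd ℂ) (refVec d r))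

theorem refVec_mul_conj (q : Fin d) : refVec d q * (starRingEnd ℂ) (refVec d q) = 1 := by
  rw [Complex.mul_conj', refVec, norm_mul, norm_omegaPow]
  split_ifs <;> simp

/-- This turns the entries of `R Z_d` into the symmetric expression `w_q w_r / d` seen in `T_d`,
with `w = refVec d`. -/
theorem conj_refVec_mul (q : Fin d) : (starRingEnd ℂ) (refVec d q) * omegaPow d (q : ℕ)
    = refVec d q := by
  have h : omegaPow d ((q : ℕ) : ℝ) = omegaPow d ((q : ℝ) / 2) * omegaPow d ((q : ℝ) / 2) := by
    rw [← omegaPow_add, add_halves]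
  have h0 := omegaPow_ne_zero d ((q : ℝ) / 2)
  rw [refVec, h, map_mul, conj_omegaPow]
  split_ifs <;> simp [h0]

theorem conjTranspose_refProj : (refProj d)ᴴ = refProj d := by
  ext q r
  rw [Matrix.conjTranspose_apply, refProj, Matrix.of_apply, Matrix.of_apply, ← starRingEnd_apply,
    map_mul, map_mul, map_inv₀, map_natCast, Complex.conj_conj]
  ring

theorem obsZ_pow (k : ℕ) :
    obsZ d ^ k = Matrix.diagonal fun q : Fin d => omegaPow d (q : ℕ) ^ k := by
  rw [obsZ, Matrix.diagonal_pow]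
  rfl

theorem conjTranspose_obsZ :
    (obsZ d)ᴴ = Matrix.diagonal fun q : Fin d => (omegaPow d (q : ℕ))⁻¹ := by
  rw [obsZ, Matrix.diagonal_conjTranspose]
  congr 1
  funext q
  rw [Pi.star_apply, ← starRingEnd_apply, conj_omegaPow]

theorem conjTranspose_obsZ_mul_self : (obsZ d)ᴴ * obsZ d = 1 := by
  rw [conjTranspose_obsZ, obsZ, Matrix.diagonal_mul_diagonal, ← Matrix.diagonal_one]
  congr 1
  funext q
  exact inv_mul_cancel₀ (omegaPow_ne_zero d _)

/-- `R = |w⟩⟨w| / d` with unimodular entries `w_q`. Hence `R Z^j R` carries the factor `∑_r ω^(rj) =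
0`, and summing `Z^j R Z⁻ʲ` over `j` kills the off-diagonal entries. -/
theorem isShiftResolution_ref (hd : d ≠ 0) :
    IsShiftResolution d (obsZ d) (obsZ d)ᴴ (refProj d) where
  mul_inv := mul_eq_one_comm.1 conjTranspose_obsZ_mul_self
  inv_mul := conjTranspose_obsZ_mul_self
  pow_order := by
    rw [obsZ_pow, ← Matrix.diagonal_one]
    congr 1
    funext q
    exact omegaPow_natCast_pow_self hd q
  orthogonal j hj0 hjd := by
    ext q s
    rw [obsZ_pow, Matrix.mul_apply]
    simp only [Matrix.mul_diagonal, refProj, Matrix.of_apply, Matrix.zero_apply]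
    have h : ∀ r : Fin d, (d : ℂ)⁻¹ * (refVec d q * (starRingEnd ℂ) (refVec d r))
          * omegaPow d (r : ℕ) ^ j * ((d : ℂ)⁻¹ * (refVec d r * (starRingEnd ℂ) (refVec d s)))
        = (d : ℂ)⁻¹ * (d : ℂ)⁻¹ * refVec d q * (starRingEnd ℂ) (refVec d s)
          * omegaPow d (r : ℕ) ^ j := fun r => by
      linear_combination (d : ℂ)⁻¹ * (d : ℂ)⁻¹ * refVec d q * (starRingEnd ℂ) (refVec d s)
          * omegaPow d (r : ℕ) ^ j * refVec_mul_conj r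
    rw [sum_congr rfl fun r _ => h r, ← mul_sum, sum_fin_pow hjd, if_neg hj0.ne', mul_zero]
  total := by
    have hd' : (d : ℂ) ≠ 0 := Nat.cast_ne_zero.2 hd
    ext q s
    rw [shiftSum, Matrix.sum_apply]
    simp only [obsZ_pow, conjTranspose_obsZ, Matrix.diagonal_pow, Matrix.mul_diagonal,
      Matrix.diagonal_mul, Pi.pow_apply]
    have h : ∀ j : ℕ, omegaPow d (q : ℕ) ^ j * refProj d q s * (omegaPow d (s : ℕ))⁻¹ ^ j
        = refProj d q s * ((omegaPow d (s : ℕ))⁻¹ * omegaPow d (q : ℕ)) ^ j := fun j => by ring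
    rw [sum_congr rfl fun j _ => h j, ← mul_sum, sum_range_inv_mul_pow, Matrix.one_apply]
    by_cases hqs : q = s
    · subst hqs
      simp [refProj, refVec_mul_conj, hd']
    · simp [hqs, Ne.symm hqs]

theorem obsT_eq : obsT d = phase d 1 • ((1 - weight 1 • refProj d) * obsZ d) := by
  ext q r
  have hr := conj_refVec_mul r
  have e : omegaPow d (((q : ℝ) + (r : ℝ) + 1) / 2)
      = omegaPow d ((q : ℝ) / 2) * omegaPow d ((r : ℝ) / 2) * omegaPow d (1 / 2) := by
    rw [← omegaPow_add, ← omegaPow_add]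
    congr 1
    ring
  have hph : phase d 1 = omegaPow d (1 / 2) := by
    rw [omegaPow_half]
    simp [phase]
  have h1 : (refProj d * obsZ d) q r = (d : ℂ)⁻¹ * (refVec d q * refVec d r) := by
    rw [obsZ, Matrix.mul_diagonal, ← hr, refProj, Matrix.of_apply]
    ring
  rw [hph, sub_mul, one_mul, smul_mul_assoc, Matrix.smul_apply, Matrix.sub_apply,
    Matrix.smul_apply, h1, obsT, obsZ, Matrix.sub_apply, Matrix.smul_apply, Matrix.of_apply, e]
  simp only [Matrix.diagonal_apply, refVec, weight, smul_eq_mul, Fin.isValue, Matrix.cons_val,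
    omegaPow_add]
  split_ifs <;> ring

theorem refObs_eq_modelPow (i : Fin 4) :
    refObs d i = modelPow d (obsZ d) (obsZ d)ᴴ (refProj d) i 1 := by
  have h0 : obsZ d = modelPow d (obsZ d) (obsZ d)ᴴ (refProj d) 0 1 := by
    simp [modelPow, phase, weight]
  have h1 : obsT d = modelPow d (obsZ d) (obsZ d)ᴴ (refProj d) 1 1 := by
    rw [obsT_eq]
    simp [modelPow, shiftSum]
  have h2 := modelPow_two (d := d) (obsZ d) (obsZ d)ᴴ (refProj d) 1
  have h3 := modelPow_three (d := d) (obsZ d) (obsZ d)ᴴ (refProj d) 1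
  rw [← h0, ← h1] at h2 h3
  fin_cases i
  · exact h0
  · exact h1
  · exact h2.symm
  · refine Eq.trans ?_ h3.symm
    rw [mul_comm (_ : ℂ) (omegaPow d _), Nat.cast_one]
    rfl

theorem refObs_pow (hd : d ≠ 0) (i : Fin 4) {k : ℕ} (hk : k ≤ d) :
    refObs d i ^ k = modelPow d (obsZ d) (obsZ d)ᴴ (refProj d) i k := by
  rw [refObs_eq_modelPow, modelPow, modelPow, ← (isShiftResolution_ref hd).smul_mul_pow _ _ hk]
  simp [shiftSum]

theorem refObs_pow_order (hd : d ≠ 0) (i : Fin 4) : refObs d i ^ d = 1 := by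
  have h := isShiftResolution_ref hd
  rw [refObs_pow hd i le_rfl, modelPow, h.total, h.pow_order, mul_one]
  calc phase d i ^ d • ((1 : Matrix (Fin d) (Fin d) ℂ) - weight i • 1)
      = (phase d i ^ d * (1 - weight i)) • 1 := by module
    _ = 1 := by rw [phase_pow_mul hd, one_smul]

theorem conjTranspose_refObs_mul_self (hd : d ≠ 0) (i : Fin 4) :
    (refObs d i)ᴴ * refObs d i = 1 := by
  have hR := (isShiftResolution_ref hd).idempotent hd
  have hp : star (phase d i) * phase d i = 1 := by
    rw [← starRingEnd_apply, Complex.conj_mul', norm_phase]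
    simp
  have hmid : (1 - weight i • refProj d)ᴴ * (1 - weight i • refProj d) = 1 := by
    rw [Matrix.conjTranspose_sub, Matrix.conjTranspose_one, Matrix.conjTranspose_smul,
      conjTranspose_refProj, sub_mul, mul_sub, mul_sub, smul_mul_smul_comm, hR, one_mul, one_mul,
      mul_one, ← starRingEnd_apply, ← weight_add_conj]
    module
  have h1 : refObs d i = phase d i • ((1 - weight i • refProj d) * obsZ d) := by
    rw [refObs_eq_modelPow]
    simp [modelPow, shiftSum]
  rw [h1, Matrix.conjTranspose_smul, smul_mul_smul_comm, hp, one_smul, Matrix.conjTranspose_mul,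
    mul_assoc, ← mul_assoc _ _ (obsZ d), hmid, one_mul, conjTranspose_obsZ_mul_self]

/-- The projective measurement of the observables `Z_d`, `T_d`, `M_d`, `N_d`. -/
def refStrategy (hd : d ≠ 0) : Strategy d d := fun i =>
  { kraus := spectralProj d (refObs d i)
    complete := by
      rw [sum_congr rfl fun a _ => conjTranspose_spectralProj_mul_self (refObs_pow_order hd i)
        (conjTranspose_refObs_mul_self hd i) a, sum_spectralProj hd] }

theorem effect_refStrategy (hd : d ≠ 0) (i : Fin 4) (a : Fin d) :
    effect (refStrategy hd i) a = spectralProj d (refObs d i) a :=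
  conjTranspose_spectralProj_mul_self (refObs_pow_order hd i)
    (conjTranspose_refObs_mul_self hd i) a

theorem isRepeatable_refStrategy (hd : d ≠ 0) (i : Fin 4) : IsRepeatable (refStrategy hd i) := by
  intro a
  have hP := spectralProj_mul_self (refObs_pow_order hd i) (conjTranspose_refObs_mul_self hd i) a
  have hH := conjTranspose_spectralProj (refObs_pow_order hd i)
    (conjTranspose_refObs_mul_self hd i) a
  rw [jointProb, prob, postState_eq]
  simp only [refStrategy, hH, mul_smul_comm, smul_mul_assoc, hP]

theorem observable_refStrategy (hd : d ≠ 0) (i : Fin 4) :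
    observable (refStrategy hd i) = refObs d i := by
  rw [observable, sum_congr rfl fun a _ => by rw [effect_refStrategy hd]]
  have := pow_eq_sum_spectralProj hd (refObs_pow_order hd i) 1
  simpa using this.symm

theorem isOptimal_refStrategy (hd : d ≠ 0) : IsOptimal (refStrategy hd) := by
  refine isOptimal_of_combinations (isRepeatable_refStrategy hd) (Nat.pos_of_ne_zero hd) hd
    (fun k _ hk => ?_) fun k _ hk => ?_
  · simp only [thirdCombination, observable_refStrategy, refObs_pow hd _ hk.le, modelPow_two]
  · simp only [fourthCombination, observable_refStrategy, refObs_pow hd _ hk.le, modelPow_three]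

theorem trace_spectralProj_refObs_mul (hd : d ≠ 0) (i j : Fin 4) (a b : Fin d) :
    (spectralProj d (refObs d i) a * spectralProj d (refObs d j) b).trace
      = d * profile d i j a b := by
  rw [(isShiftResolution_ref hd).trace_spectralProj_mul (fun k hk => refObs_pow hd i hk.le)
    (fun k hk => refObs_pow hd j hk.le), Fintype.card_fin]

/-- Each eigenvalue `ω^a` is thus simple, so a normalized eigenvector determines its projection. -/
theorem trace_spectralProj_refObs (hd : d ≠ 0) (i : Fin 4) (a : Fin d) :
    (spectralProj d (refObs d i) a).trace = 1 := by
  rw [← spectralProj_mul_self (refObs_pow_order hd i) (conjTranspose_refObs_mul_self hd i),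
    trace_spectralProj_refObs_mul hd, profile_self, if_pos rfl,
    mul_inv_cancel₀ (Nat.cast_ne_zero.2 hd)]

/-! ### Eigenstates -/

theorem exists_isEigenstateFamily (hd : d ≠ 0) :
    ∃ v : Fin 4 → Fin d → EuclideanSpace ℂ (Fin d), IsEigenstateFamily v := by
  have h : ∀ i a, ∃ w : EuclideanSpace ℂ (Fin d), ‖w‖ = 1 ∧
      Matrix.toEuclideanLin (refObs d i) w = omegaPow d ((a : Fin d) : ℝ) • w := by
    intro i a
    have hne : spectralProj d (refObs d i) a ≠ 0 := by
      intro h0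
      have := trace_spectralProj_refObs hd i a
      rw [h0, Matrix.trace_zero] at this
      exact zero_ne_one this
    set L := Matrix.toEuclideanLin (spectralProj d (refObs d i) a) with hL
    have hL0 : L ≠ 0 := by
      rw [hL]
      simpa using hne
    obtain ⟨x, hx⟩ : ∃ x, L x ≠ 0 := by
      by_contra! hcon
      exact hL0 (LinearMap.ext hcon)
    have heig : Matrix.toEuclideanLin (refObs d i) (L x) = omegaPow d ((a : ℕ) : ℝ) • L x := by
      have := mul_spectralProj (refObs_pow_order hd i) a
      apply (WithLp.equiv 2 (Fin d → ℂ)).injective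
      have h2 := congrArg (· *ᵥ x.ofLp) this
      simpa [hL, Matrix.toLpLin_apply, Matrix.mulVec_mulVec, Matrix.smul_mulVec] using h2
    refine ⟨((‖L x‖ : ℂ))⁻¹ • L x, ?_, ?_⟩
    · rw [norm_smul, norm_inv, Complex.norm_real, norm_norm,
        inv_mul_cancel₀ (norm_ne_zero_iff.2 hx)]
    · rw [map_smul, heig, smul_comm]
  choose v hv using h
  exact ⟨v, hv⟩

theorem IsEigenstateFamily.spectralProj_eq (hd : d ≠ 0)
    {v : Fin 4 → Fin d → EuclideanSpace ℂ (Fin d)} (hv : IsEigenstateFamily v) (i : Fin 4)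
    (a : Fin d) : spectralProj d (refObs d i) a
      = Matrix.vecMulVec (v i a).ofLp (star (v i a).ofLp) := by
  obtain ⟨hnorm, heig⟩ := hv i a
  refine eq_vecMulVec_of_trace_eq_one
    (conjTranspose_spectralProj (refObs_pow_order hd i) (conjTranspose_refObs_mul_self hd i) a)
    (spectralProj_mul_self (refObs_pow_order hd i) (conjTranspose_refObs_mul_self hd i) a)
    (trace_spectralProj_refObs hd i a) ?_ (spectralProj_mulVec ?_)
  · have := inner_self_eq_norm_sq_to_K (𝕜 := ℂ) (v i a)
    rw [hnorm, EuclideanSpace.inner_eq_star_dotProduct] at this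
    rw [dotProduct_comm]
    simpa using this
  · have := congrArg WithLp.ofLp heig
    simpa [Matrix.toLpLin_apply] using this

theorem IsEigenstateFamily.overlap_eq (hd : d ≠ 0)
    {v : Fin 4 → Fin d → EuclideanSpace ℂ (Fin d)} (hv : IsEigenstateFamily v) (i j : Fin 4)
    (a b : Fin d) : (overlap (v i a) (v j b) : ℂ) = d * profile d i j a b := by
  rw [← trace_spectralProj_refObs_mul hd, hv.spectralProj_eq hd, hv.spectralProj_eq hd,
    Matrix.vecMulVec_mul_vecMulVec, Matrix.trace_vecMulVec, dotProduct_smul, overlap,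
    EuclideanSpace.inner_eq_star_dotProduct]
  push_cast
  rw [← Complex.mul_conj', smul_eq_mul, starRingEnd_apply, ← Matrix.star_dotProduct_star,
    star_star, dotProduct_comm (star (v i a).ofLp)]

end Reference

/-! ### The certified randomness -/

/-- The conditional probability of `b` given `a` in any optimal strategy. -/
def optimalProb (d : ℕ) (i j : Fin 4) (a b : Fin d) : ℝ := d * (profile d i j a b).re

theorem IsEigenstateFamily.overlap_eq_optimalProb {d : ℕ} (hd : d ≠ 0)
    {v : Fin 4 → Fin d → EuclideanSpace ℂ (Fin d)} (hv : IsEigenstateFamily v) (i j : Fin 4)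
    (a b : Fin d) : overlap (v i a) (v j b) = optimalProb d i j a b := by
  have h := congrArg Complex.re (hv.overlap_eq hd i j a b)
  rwa [Complex.ofReal_re, ← Complex.ofReal_natCast, Complex.re_ofReal_mul] at h

/-! ### Sums of periodic functions over residues -/

theorem periodic_apply_fin_sub {α : Type*} {d : ℕ} [NeZero d] {g : ℝ → α}
    (hg : Function.Periodic g d) (x y : Fin d) :
    g ((x - y : Fin d) : ℕ) = g ((x : ℕ) - (y : ℕ)) := by
  rcases le_or_gt y x with h | h
  · rw [Fin.coe_sub_iff_le.2 h, Nat.cast_sub h]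
  · rw [Fin.coe_sub_iff_lt.2 h, ← hg ((x : ℕ) - (y : ℕ)), Nat.cast_sub (by omega)]
    congr 1
    push_cast
    ring

theorem sum_periodic_sub_right {M : Type*} [AddCommMonoid M] {d : ℕ} {g : ℝ → M}
    (hg : Function.Periodic g d) (a : Fin d) :
    ∑ b : Fin d, g ((b : ℕ) - (a : ℕ)) = ∑ k ∈ range d, g k := by
  have : NeZero d := ⟨(Fin.pos a).ne'⟩
  rw [← Fin.sum_univ_eq_sum_range (fun k => g k),
    ← Equiv.sum_comp (Equiv.subRight a) fun b : Fin d => g (b : ℕ)]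
  exact sum_congr rfl fun b _ => (periodic_apply_fin_sub hg b a).symm

theorem sum_periodic_sub_left {M : Type*} [AddCommMonoid M] {d : ℕ} {g : ℝ → M}
    (hg : Function.Periodic g d) (a : Fin d) :
    ∑ b : Fin d, g ((a : ℕ) - (b : ℕ)) = ∑ k ∈ range d, g k := by
  have : NeZero d := ⟨(Fin.pos a).ne'⟩
  rw [← Fin.sum_univ_eq_sum_range (fun k => g k),
    ← Equiv.sum_comp (Equiv.subLeft a) fun b : Fin d => g (b : ℕ)]
  exact sum_congr rfl fun b _ => (periodic_apply_fin_sub hg a b).symm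

theorem omegaPow_periodic {d : ℕ} (hd : d ≠ 0) : Function.Periodic (omegaPow d) d := fun t => by
  rw [omegaPow_add, omegaPow_self hd, mul_one]

/-- The entropy of the second outcome given the first outcome `a`, in any optimal strategy. -/
def optimalEntropy (d : ℕ) (i j : Fin 4) (a : Fin d) : ℝ :=
  -∑ b, optimalProb d i j a b * Real.logb 2 (optimalProb d i j a b)

/-- The distribution depends only on `b - a` modulo `d`, so changing `a` permutes the summands. -/
theorem optimalEntropy_eq {d : ℕ} (i j : Fin 4) (a a' : Fin d) :
    optimalEntropy d i j a = optimalEntropy d i j a' := by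
  have hd : d ≠ 0 := (Fin.pos a).ne'
  let f : ℝ → ℝ := fun t => d * (shiftProfile d i j (omegaPow d t)).re
  have hg : Function.Periodic (fun t => f t * Real.logb 2 (f t)) d := fun t => by
    simp only [f, omegaPow_periodic hd t]
  simp only [optimalEntropy, optimalProb, profile_eq_shiftProfile]
  rw [sum_periodic_sub_right hg a, sum_periodic_sub_right hg a']

theorem IsOptimal.prob_eq {d D : ℕ} {A : Strategy d D} (hA : IsOptimal A) (i : Fin 4)
    (a : Fin d) : prob (A i) a = (d : ℝ)⁻¹ := by
  have hd : d ≠ 0 := (Fin.pos a).ne'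
  have h : ∑ b, (jointProb (A i) (A i) a b : ℂ) = (d : ℂ)⁻¹ := by
    simp only [hA.jointProb_eq_profile hd, profile_self]
    simp
  rw [← sum_jointProb (A i) (A i) a]
  apply Complex.ofReal_injective
  push_cast
  exact h

theorem IsOptimal.condProb_eq {d D : ℕ} {A : Strategy d D} (hA : IsOptimal A) (i j : Fin 4)
    (a b : Fin d) : condProb (A i) (A j) a b = optimalProb d i j a b := by
  have hd : d ≠ 0 := (Fin.pos a).ne'
  rw [condProb, hA.prob_eq, optimalProb, ← hA.jointProb_eq_profile hd, Complex.ofReal_re,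
    div_inv_eq_mul, mul_comm]

theorem IsOptimal.outcomeEntropy_eq {d D : ℕ} {A : Strategy d D} (hA : IsOptimal A)
    (i j : Fin 4) (a : Fin d) : outcomeEntropy (A i) (A j) = optimalEntropy d i j a := by
  have hd : (d : ℝ) ≠ 0 := Nat.cast_ne_zero.2 (Fin.pos a).ne'
  have h : ∀ a' : Fin d, prob (A i) a' * ∑ b, condProb (A i) (A j) a' b
      * Real.logb 2 (condProb (A i) (A j) a' b) = (d : ℝ)⁻¹ * -optimalEntropy d i j a := fun a' => by
    rw [optimalEntropy_eq i j a a', optimalEntropy, neg_neg, hA.prob_eq]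
    simp only [hA.condProb_eq]
  rw [outcomeEntropy, sum_congr rfl fun a' _ => h a']
  simp [hd]

/-- Optimality fixes the entropy, and the reference strategy shows that the set is nonempty; hence
the minimum exists. -/
theorem strategyEntropies_eq {d : ℕ} (i j : Fin 4) (a : Fin d) :
    strategyEntropies d i j = {optimalEntropy d i j a} := by
  have hd : d ≠ 0 := (Fin.pos a).ne'
  ext h
  constructor
  · rintro ⟨D, A, hA, rfl⟩
    exact hA.outcomeEntropy_eq i j a
  · rintro rfl
    exact ⟨d, refStrategy hd, isOptimal_refStrategy hd,
      ((isOptimal_refStrategy hd).outcomeEntropy_eq i j a).symm⟩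

theorem certifiedRandomness_eq {d : ℕ} (i j : Fin 4) (a : Fin d) :
    certifiedRandomness d i j = optimalEntropy d i j a := by
  rw [certifiedRandomness, strategyEntropies_eq i j a, csInf_singleton]

theorem optimalProb_zero_one {d : ℕ} (a b : Fin d) :
    optimalProb d 0 1 a b = closedFormProb d (((b : ℕ) : ℝ) - (a : ℕ) - 1 / 2) := by
  have hd : (d : ℝ) ≠ 0 := Nat.cast_ne_zero.2 (Fin.pos a).ne'
  rw [optimalProb, profile_zero_one, Complex.ofReal_re]
  field_simp

theorem optimalProb_one_zero {d : ℕ} (a b : Fin d) :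
    optimalProb d 1 0 a b = closedFormProb d (((a : ℕ) : ℝ) - (b : ℕ) - 1 / 2) := by
  rw [← optimalProb_zero_one, optimalProb, optimalProb, profile_comm]

theorem optimalProb_two_three {d : ℕ} (a b : Fin d) :
    optimalProb d 2 3 a b = optimalProb d 0 1 a b := by
  rw [optimalProb, optimalProb, profile_two_three]

theorem optimalProb_three_two {d : ℕ} (a b : Fin d) :
    optimalProb d 3 2 a b = optimalProb d 1 0 a b := by
  rw [optimalProb, optimalProb, profile_comm, profile_two_three, profile_comm]

theorem closedForm_periodic {d : ℕ} (hd : d ≠ 0) : Function.Periodic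
    (fun t : ℝ => closedFormProb d (t - 1 / 2) * Real.logb 2 (closedFormProb d (t - 1 / 2))) d := by
  intro t
  have h : closedFormProb d (t + d - 1 / 2) = closedFormProb d (t - 1 / 2) := by
    rw [closedFormProb, closedFormProb, add_sub_right_comm, omegaPow_periodic hd]
  simp only [h]

theorem optimalEntropy_zero_one {d : ℕ} (a : Fin d) :
    optimalEntropy d 0 1 a = closedFormEntropy d := by
  simp only [optimalEntropy, optimalProb_zero_one]
  rw [sum_periodic_sub_right (closedForm_periodic (Fin.pos a).ne') a, closedFormEntropy]

theorem optimalEntropy_one_zero {d : ℕ} (a : Fin d) :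
    optimalEntropy d 1 0 a = closedFormEntropy d := by
  simp only [optimalEntropy, optimalProb_one_zero]
  rw [sum_periodic_sub_left (closedForm_periodic (Fin.pos a).ne') a, closedFormEntropy]

theorem optimalEntropy_self {d : ℕ} (i : Fin 4) (a : Fin d) : optimalEntropy d i i a = 0 := by
  have hd : d ≠ 0 := (Fin.pos a).ne'
  rw [optimalEntropy, neg_eq_zero]
  refine sum_eq_zero fun b _ => ?_
  rw [optimalProb, profile_self]
  split_ifs <;> simp [← Complex.ofReal_natCast, hd, -Complex.ofReal_inv]

end TemporalRandomness

end

open TemporalRandomness in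
theorem mainTheorem7 (d : ℕ) (hd : 2 ≤ d) :
    -- the minimum defining the certified randomness is attained, and all admissible
    -- strategies give the same value
    (∀ i j : Fin 4,
      IsLeast (TemporalRandomness.strategyEntropies d i j)
        (TemporalRandomness.certifiedRandomness d i j)) ∧
    (∀ (D : ℕ) (A : TemporalRandomness.Strategy d D), TemporalRandomness.IsOptimal A →
      ∀ i j : Fin 4, TemporalRandomness.outcomeEntropy (A i) (A j) =
        TemporalRandomness.certifiedRandomness d i j) ∧
    -- the certified randomness in terms of the overlaps of the eigenstates
    (∃ v : Fin 4 → Fin d → EuclideanSpace ℂ (Fin d),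
      TemporalRandomness.IsEigenstateFamily v) ∧
    (∀ v : Fin 4 → Fin d → EuclideanSpace ℂ (Fin d),
      TemporalRandomness.IsEigenstateFamily v →
      (∀ (i j : Fin 4) (a : Fin d), TemporalRandomness.certifiedRandomness d i j =
        -∑ b : Fin d, TemporalRandomness.overlap (v i a) (v j b) *
          Real.logb 2 (TemporalRandomness.overlap (v i a) (v j b))) ∧
      (∀ a b : Fin d, TemporalRandomness.overlap (v 0 a) (v 1 b) =
        TemporalRandomness.closedFormProb d ((b : ℝ) - (a : ℝ) - 1 / 2))) ∧
    -- no randomness from repeating a measurement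
    (∀ i : Fin 4, TemporalRandomness.certifiedRandomness d i i = 0) ∧
    -- the closed form for the orders (1,2), (2,1), (3,4), (4,3)
    TemporalRandomness.certifiedRandomness d 0 1 = TemporalRandomness.closedFormEntropy d ∧
    TemporalRandomness.certifiedRandomness d 1 0 = TemporalRandomness.closedFormEntropy d ∧
    TemporalRandomness.certifiedRandomness d 2 3 = TemporalRandomness.closedFormEntropy d ∧
    TemporalRandomness.certifiedRandomness d 3 2 = TemporalRandomness.closedFormEntropy d := by
  have hd0 : d ≠ 0 := by omega
  -- Any outcome serves, since the entropy does not depend on it.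
  let a₀ : Fin d := ⟨0, by omega⟩
  refine ⟨fun i j => ?_, fun D A hA i j => ?_, exists_isEigenstateFamily hd0,
    fun v hv => ⟨fun i j a => ?_, fun a b => ?_⟩, fun i => ?_, ?_, ?_, ?_, ?_⟩
  · rw [certifiedRandomness_eq i j a₀, strategyEntropies_eq i j a₀]
    exact isLeast_singleton
  · rw [certifiedRandomness_eq i j a₀, hA.outcomeEntropy_eq i j a₀]
  · rw [certifiedRandomness_eq i j a, optimalEntropy]
    simp only [hv.overlap_eq_optimalProb hd0]
  · rw [hv.overlap_eq_optimalProb hd0, optimalProb_zero_one]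
  · rw [certifiedRandomness_eq i i a₀, optimalEntropy_self]
  · rw [certifiedRandomness_eq 0 1 a₀, optimalEntropy_zero_one]
  · rw [certifiedRandomness_eq 1 0 a₀, optimalEntropy_one_zero]
  · rw [certifiedRandomness_eq 2 3 a₀, ← optimalEntropy_zero_one a₀]
    simp only [optimalEntropy, optimalProb_two_three]
  · rw [certifiedRandomness_eq 3 2 a₀, ← optimalEntropy_one_zero a₀]
    simp only [optimalEntropy, optimalProb_three_two]
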